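/- Let $m,l\ge 1$ be integers and $\alpha\ge 0$ a real number, and let $x=(x_1,\dots,x_m)\in[0,\infty)^m$ be distributed according to the Wishart--Laguerre ensemble, i.e. with joint density proportional to $\prod_{1\le i<j\le m}(x_i-x_j)^2\prod_{i=1}^m x_i^{\alpha}e^{-x_i}$. Let $w(x)=x^\alpha e^{-x}$, let $L_k^{(\alpha)}(x)=\sum_{j=0}^{k}(-1)^j\binom{k+\alpha}{k-j}\frac{x^j}{j!}$ be the generalized Laguerre polynomials, and let $$K(x,y)=\sqrt{w(x)w(y)}\sum_{k=0}^{m-1}\frac{k!}{\Gamma(k+\alpha+1)}L_k^{(\alpha)}(x)L_k^{(\alpha)}(y)$$ be the correlation kernel. Let $f_1,\dots,f_l$ be measurable real functions, $X_r=\sum_{i=1}^m f_r(x_i)$ the corresponding linear statistics, and assume $\mathbb{E}\big[\sum_{i=1}^m|f_r(x_i)|^l\big]<\infty$ for every $r$. Put $$S=\sum_{\{p_1,\dots,p_i\}\in\mathcal{P}_L}\ \sum_{\sigma\in S_i}\frac{(-1)^{i-1}}{i}\int_{[0,\infty)^i}\prod_{j=1}^{i}\Big(\prod_{r\in p_j}f_r(x_{\sigma(j)})\Big)K(x_j,x_{j+1})\,\mathrm{d}x_j,\qquad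 x_{i+1}=x_1,$$ where $\mathcal{P}_L$ is the set of all partitions of $L=\{1,\dots,l\}$ into non-empty blocks ($i$ being the number of blocks) and $S_i$ is the symmetric group on $\{1,\dots,i\}$. Then all the integrals in $S$ converge absolutely, all moments $\mathbb{E}\big[\prod_{r\in B}X_r\big]$, $B\subseteq L$, exist, and the joint cumulant of $X_1,\dots,X_l$ is given by $$\kappa_l(X_1,\dots,X_l)=S$$ in both of the following senses. (a) Let $K_l(t)=\ln\mathbb{E}\big[e^{\sum_{r=1}^{l}t_rX_r}\big]$ be the cumulant generating function, and suppose that $\mathbb{E}\big[e^{\sum_r t_rX_r}\big]<\infty$ for all $t$ in a box $Q=\prod_{r=1}^{l}[a_r,b_r]$ with $a_r\le 0\le b_r$ and $a_r<b_r$, and that $\mathbb{E}\big[\sum_{i=1}^m|f_r(x_i)|^p\big]<\infty$ for all $r$ and all $p\in\mathbb{N}$ (which is automatic if $a_r<0<b_r$ for all $r$). Then $K_l$ is $l$ times continuously differentiable within $Q$ near $t=0$, and its mixed derivative within $Q$ (one-sided in $t_r$ if $a_r=0$ or $b_r=0$) satisfies $$\frac{\partial^l K_l}{\partial t_1\cdots\partial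 t_l}\bigg|_{t=0}=S.$$ (b) In terms of moments, $$\sum_{\{P_1,\dots,P_s\}\in\mathcal{P}_L}(-1)^{s-1}(s-1)!\prod_{q=1}^{s}\mathbb{E}\Big[\prod_{r\in P_q}X_r\Big]=S.$$ -/

import Mathlib

open MeasureTheory

noncomputable section

namespace LaguerreEnsemble

/-- The weight `w(x) = x ^ α * e ^ (-x)`. -/
def weight (α x : ℝ) : ℝ := x ^ α * Real.exp (-x)

/-- The generalized Laguerre polynomial
`L_k^{(α)}(x) = ∑_{j ≤ k} (-1)^j * binom(k + α, k - j) * x^j / j!`,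
the binomial coefficient being `Γ(k + α + 1) / ((k - j)! Γ(α + j + 1))`. -/
def laguerre (α : ℝ) (k : ℕ) (x : ℝ) : ℝ :=
  ∑ j ∈ Finset.range (k + 1),
    (-1) ^ j * (Real.Gamma (k + α + 1) / ((k - j).factorial * Real.Gamma (α + j + 1)))
      * (x ^ j / j.factorial)

/-- The correlation kernel
`K(x, y) = √(w(x) w(y)) ∑_{k < m} k! / (k + α)! * L_k^{(α)}(x) L_k^{(α)}(y)`,
where `(k + α)! = Γ(k + α + 1)`. -/
def kernel (m : ℕ) (α x y : ℝ) : ℝ :=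
  Real.sqrt (weight α x * weight α y) *
    ∑ k ∈ Finset.range m,
      (k.factorial / Real.Gamma (k + α + 1)) * (laguerre α k x * laguerre α k y)

/-- The unnormalized joint eigenvalue density
`∏_{i < j} (x_i - x_j)^2 * ∏_i x_i ^ α * e ^ (-x_i)`. -/
def density (m : ℕ) (α : ℝ) (x : Fin m → ℝ) : ℝ :=
  (∏ i : Fin m, ∏ j ∈ Finset.Ioi i, (x i - x j) ^ 2) * ∏ i : Fin m, weight α (x i)

/-- The measure on `[0, ∞)^m` with the unnormalized joint density. -/
def unnormalized (m : ℕ) (α : ℝ) : Measure (Fin m → ℝ) :=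
  (volume.restrict (Set.univ.pi fun _ : Fin m => Set.Ici (0 : ℝ))).withDensity
    fun x => ENNReal.ofReal (density m α x)

/-- The law of the Wishart-Laguerre ensemble: the probability measure on `[0, ∞)^m` whose
density is proportional to `∏_{i < j} (x_i - x_j)^2 * ∏_i x_i ^ α * e ^ (-x_i)`. -/
def law (m : ℕ) (α : ℝ) : Measure (Fin m → ℝ) :=
  (unnormalized m α Set.univ)⁻¹ • unnormalized m α

/-- The linear statistic `X = ∑_i f(x_i)`. -/
def linStat (m : ℕ) (f : ℝ → ℝ) (x : Fin m → ℝ) : ℝ := ∑ i, f (x i)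

/-- The integrand `∏_j F_j K(x_j, x_{j+1})` on `ℝ^i`, where `p_1, …, p_i` are the blocks of `P`,
`F_j = ∏_{r ∈ p_j} f_r(x_{σ(j)})`, and `j + 1` is taken cyclically (`finRotate`). The blocks
carry an arbitrary numbering; the sum over all permutations `σ` of the integrals over `[0, ∞)^i`
does not depend on it. -/
def cyclicIntegrand (m : ℕ) (α : ℝ) {l : ℕ} (f : Fin l → ℝ → ℝ)
    (P : Finpartition (Finset.univ : Finset (Fin l))) (σ : Equiv.Perm (Fin P.parts.card))
    (x : Fin P.parts.card → ℝ) : ℝ :=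
  ∏ j, (∏ r ∈ (P.parts.equivFin.symm j : Finset (Fin l)), f r (x (σ j))) *
    kernel m α (x j) (x (finRotate _ j))

end LaguerreEnsemble

/-- The cumulant generating function `K(t) = ln E[exp(∑_r t_r X_r)]`. -/
def jointCGF {Ω : Type*} [MeasurableSpace Ω] (μ : Measure Ω) {l : ℕ} (X : Fin l → Ω → ℝ)
    (t : Fin l → ℝ) : ℝ :=
  Real.log (∫ ω, Real.exp (∑ r, t r * X r ω) ∂μ)

/-- The joint cumulant of `X_1, …, X_l` expressed through joint moments:
`∑_{{P_1, …, P_s}} (-1)^(s-1) (s-1)! ∏_q E[∏_{r ∈ P_q} X_r]`,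
the sum being over the set partitions of the index set. -/
def momentCumulant {Ω : Type*} [MeasurableSpace Ω] (μ : Measure Ω) {l : ℕ}
    (X : Fin l → Ω → ℝ) : ℝ :=
  ∑ P : Finpartition (Finset.univ : Finset (Fin l)),
    (-1) ^ (P.parts.card - 1) * ((P.parts.card - 1).factorial : ℝ) *
      ∏ B ∈ P.parts, ∫ ω, ∏ r ∈ B, X r ω ∂μ

end

/-! The ensemble is determinantal. With the orthonormal functions `φ_k = √(w k!/Γ(k+α+1)) L_k`, the
Vandermonde determinant turns the normalized density into `det (φ_k(x_i))² / m!`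
(`density_eq_slater_sq`, `law_eq_ensemble`), and the correlation kernel is `K(x, y) = ∑_k φ_k(x)
φ_k(y)`.

Attach a formal variable `t_r` to each `f_r`, let `a_B` be multiplication by `∏_{r ∈ B} f_r`
compressed to the span of the `φ_k`, and put `A = ∑_{B ≠ ∅} t^B a_B`. Andréief's formula makes the
joint moments the squarefree coefficients of `det (1 + A)` (`integral_ensemble_prod`). The cumulants
should then be those of `log det (1 + A) = ∑_p (-1)^(p-1)/p tr (A^p)`. In `tr (A^p)` the coefficient
of `t_1 ⋯ t_l` is a sum over ordered partitions into `p` non-empty blocks, and each trace `tr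
(a_{c_1} ⋯ a_{c_p})` is a cyclic integral of kernels, which gives `S` (`coeff_logDet_genMatrix`).

All notions of cumulant are compared through the recursion `m(B ∪ r) = ∑_{C ⊆ B} κ(C ∪ r) m(B \ C)`,
which has only one solution (`cumulant_unique`). It holds for the coefficients of the logarithm by
Jacobi's formula (`coeff_det_one_add`), for the moment formula by a cancellation over set partitions
(`partitionCumulant_recursion`), and for the derivatives of the generating function by the Leibniz
rule (`mixedDeriv_log`).

The analytic input is twofold. The moments of order `l` make all integrands integrable
(`integrable_prod_mul_mul`). Finiteness of the exponential moments on a box, with all moments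
finite, gives smoothness within the half-size box, by domination at its vertices
(`integrable_expEnvelope_sq`). -/

noncomputable section

set_option linter.unusedSectionVars false

namespace LaguerreEnsemble

open MvPolynomial

/-! ### Derivatives of determinants and of traces of powers. -/

section Jacobi

variable {k R n : Type*} [CommRing k] [CommRing R] [Algebra k R] [Fintype n] [DecidableEq n]

theorem derivation_prod {ι : Type*} [DecidableEq ι] (d : Derivation k R R) (s : Finset ι)
    (u : ι → R) : d (∏ i ∈ s, u i) = ∑ i ∈ s, d (u i) * ∏ j ∈ s.erase i, u j := by
  induction s using Finset.induction_on with
  | empty => simp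
  | insert a s ha ih =>
    rw [Finset.prod_insert ha, Derivation.leibniz, ih, Finset.sum_insert ha,
      Finset.erase_insert ha, smul_eq_mul, smul_eq_mul, Finset.mul_sum, add_comm]
    congr 1
    · ring
    · refine Finset.sum_congr rfl fun i hi => ?_
      have hia : a ≠ i := fun h => ha (h ▸ hi)
      rw [Finset.erase_insert_of_ne hia, Finset.prod_insert (by simp [ha])]
      ring

/-- Jacobi's formula for the derivative of a determinant. -/
theorem derivation_det (d : Derivation k R R) (M : Matrix n n R) :
    d M.det = (M.adjugate * M.map d).trace := by
  -- By Cramer's rule each diagonal entry is the determinant with one column differentiated.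
  have h1 : (M.adjugate * M.map d).trace = ∑ i, (M.updateCol i fun j => d (M j i)).det := by
    simp only [Matrix.trace, Matrix.diag_apply]
    refine Finset.sum_congr rfl fun i _ => ?_
    rw [← Matrix.cramer_apply, Matrix.cramer_eq_adjugate_mulVec]
    rfl
  rw [h1, Matrix.det_apply', map_sum]
  simp only [Matrix.det_apply']
  rw [Finset.sum_comm]
  refine Finset.sum_congr rfl fun σ _ => ?_
  rw [Derivation.leibniz, Derivation.map_intCast, smul_zero, add_zero, smul_eq_mul,
    derivation_prod, Finset.mul_sum]
  refine Finset.sum_congr rfl fun i _ => ?_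
  rw [← Finset.mul_prod_erase Finset.univ _ (Finset.mem_univ i)]
  congr 2
  · simp
  · refine Finset.prod_congr rfl fun j hj => ?_
    rw [Matrix.updateCol_ne (Finset.ne_of_mem_erase hj)]

theorem map_derivation_mul (d : Derivation k R R) (M N : Matrix n n R) :
    (M * N).map d = M.map d * N + M * N.map d := by
  ext i j
  simp only [Matrix.map_apply, Matrix.mul_apply, Matrix.add_apply, map_sum, Derivation.leibniz,
    smul_eq_mul, ← Finset.sum_add_distrib]
  exact Finset.sum_congr rfl fun x _ => by ring

theorem trace_map_derivation (d : Derivation k R R) (M : Matrix n n R) :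
    (M.map d).trace = d M.trace := by
  simp [Matrix.trace, map_sum]

/-- Under the trace, a factor that commutes with `M` collects all the powers of `M`. The extra `N`
is what makes the induction close: each step absorbs one factor `M` into it. -/
theorem trace_mul_map_derivation_pow (d : Derivation k R R) (M N : Matrix n n R)
    (h : Commute M N) (p : ℕ) :
    (N * (M ^ p).map d).trace = p * (N * M ^ (p - 1) * M.map d).trace := by
  induction p generalizing N with
  | zero => 
    have : ((1 : Matrix n n R).map d) = 0 := by
      ext i j
      rcases eq_or_ne i j with rfl | hij <;> simp [*]
    simp [this]
  | succ p ih =>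
    rw [pow_succ', map_derivation_mul, mul_add, Matrix.trace_add, ← mul_assoc, ← mul_assoc,
      ih _ (h.symm.mul_left (Commute.refl M)).symm]
    rw [Matrix.trace_mul_comm (N * M.map d), ← mul_assoc, (h.pow_left p).eq]
    rcases p with _ | p
    · simp
    · rw [mul_assoc N M, Nat.add_sub_cancel, ← pow_succ', Nat.add_sub_cancel]
      push_cast
      ring

theorem derivation_trace_pow (d : Derivation k R R) (M : Matrix n n R) (p : ℕ) :
    d (M ^ p).trace = p * (M ^ (p - 1) * M.map d).trace := by
  have := trace_mul_map_derivation_pow d M 1 (Commute.one_right M) p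
  rwa [one_mul, one_mul, trace_map_derivation] at this

end Jacobi

/-! ### Squarefree coefficients of multivariate polynomials. -/

section SquarefreeCoeff

variable {ι : Type*} [DecidableEq ι] {R : Type*} [CommRing R]

/-- The exponent vector of the squarefree monomial `∏_{i ∈ B} t_i`. -/
def ind (B : Finset ι) : ι →₀ ℕ := ∑ i ∈ B, Finsupp.single i 1

theorem ind_apply (B : Finset ι) (i : ι) : ind B i = if i ∈ B then 1 else 0 := by
  simp [ind, Finsupp.finsetSum_apply, Finsupp.single_apply]

theorem support_ind (B : Finset ι) : (ind B).support = B := by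
  ext i
  simp [ind_apply]

theorem ind_injective : Function.Injective (ind : Finset ι → ι →₀ ℕ) := fun B C h => by
  rw [← support_ind B, h, support_ind]

theorem degree_ind (B : Finset ι) : (ind B).degree = B.card := by
  simp [ind, map_sum]

theorem ind_insert {r : ι} {B : Finset ι} (h : r ∉ B) :
    ind (insert r B) = ind B + Finsupp.single r 1 := by
  rw [ind, Finset.sum_insert h, add_comm, ind]

/-- The divisors of a squarefree monomial correspond to the subsets of its variables. -/
theorem coeff_ind_mul (p q : MvPolynomial ι R) (B : Finset ι) :
    coeff (ind B) (p * q) = ∑ C ∈ B.powerset, coeff (ind C) p * coeff (ind (B \ C)) q := by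
  rw [coeff_mul]
  symm
  refine Finset.sum_bij' (fun C _ => (ind C, ind (B \ C))) (fun u _ => u.1.support) ?_ ?_ ?_ ?_ ?_
  · intro C hC
    rw [Finset.mem_powerset] at hC
    rw [Finset.HasAntidiagonal.mem_antidiagonal]
    ext i
    simp only [Finsupp.add_apply, ind_apply, Finset.mem_sdiff]
    have := @hC i
    by_cases h1 : i ∈ C <;> by_cases h2 : i ∈ B <;> simp_all
  · rintro ⟨u, v⟩ h
    rw [Finset.HasAntidiagonal.mem_antidiagonal] at h
    rw [Finset.mem_powerset]
    intro i hi
    have := DFunLike.congr_fun h i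
    simp only [Finsupp.add_apply, ind_apply] at this
    have hi' := Finsupp.mem_support_iff.1 hi
    dsimp only at hi'
    by_contra hB
    rw [if_neg hB] at this
    omega
  · intro C _
    exact support_ind C
  · rintro ⟨u, v⟩ h
    rw [Finset.HasAntidiagonal.mem_antidiagonal] at h
    have key : ∀ i, u i + v i = if i ∈ B then 1 else 0 := fun i => by
      have := DFunLike.congr_fun h i
      simpa only [Finsupp.add_apply, ind_apply] using this
    refine Prod.ext ?_ ?_
    · ext i
      have := key i
      simp only [ind_apply, Finsupp.mem_support_iff]
      split_ifs at * <;> omega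
    · ext i
      have := key i
      simp only [ind_apply, Finsupp.mem_support_iff, Finset.mem_sdiff]
      grind
  · intro C _
    rfl

theorem coeff_ind_pderiv (p : MvPolynomial ι R) {r : ι} {B : Finset ι} (h : r ∉ B) :
    coeff (ind B) (pderiv r p) = coeff (ind (insert r B)) p := by
  rw [coeff_pderiv, ind_insert h, ind_apply, if_neg h]
  simp

variable [Fintype ι]

/-- The polynomial with squarefree monomials and prescribed coefficients. -/
def gen (u : Finset ι → R) : MvPolynomial ι R := ∑ B, monomial (ind B) (u B)

theorem coeff_gen (u : Finset ι → R) (B : Finset ι) : coeff (ind B) (gen u) = u B := by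
  simp [gen, coeff_sum, coeff_monomial, ind_injective.eq_iff]

/-- The families of sets that form an ordered partition of `B` into possibly empty parts. -/
def splittings (J : Type*) [Fintype J] (B : Finset ι) [DecidableEq J] : Finset (J → Finset ι) :=
  {c | ∑ j, ind (c j) = ind B}

theorem mem_splittings {J : Type*} [Fintype J] [DecidableEq J] {B : Finset ι}
    {c : J → Finset ι} : c ∈ splittings J B ↔ ∑ j, ind (c j) = ind B := by
  simp [splittings]

theorem coeff_ind_prod_gen {J : Type*} [Fintype J] [DecidableEq J] (u : J → Finset ι → R)
    (B : Finset ι) :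
    coeff (ind B) (∏ j, gen (u j)) = ∑ c ∈ splittings J B, ∏ j, u j (c j) := by
  simp only [gen]
  rw [Finset.prod_univ_sum, coeff_sum, splittings, Finset.sum_filter, Fintype.piFinset_univ]
  refine Finset.sum_congr rfl fun c _ => ?_
  have : ∀ s : Finset J, ∏ j ∈ s, monomial (ind (c j)) (u j (c j)) =
      monomial (∑ j ∈ s, ind (c j)) (∏ j ∈ s, u j (c j)) := fun s => by
    induction s using Finset.induction_on with
    | empty => simp
    | insert a s ha ih =>
      rw [Finset.prod_insert ha, ih, monomial_mul, Finset.sum_insert ha, Finset.prod_insert ha]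
  rw [this, coeff_monomial]

/-- Expansion of a product of sums according to the indices that are chosen. -/
theorem prod_sum_eq_sum_splittings {J : Type*} [Fintype J] [DecidableEq J] (y : ι → J → R)
    (B : Finset ι) :
    ∏ r ∈ B, ∑ j, y r j = ∑ c ∈ splittings J B, ∏ j, ∏ r ∈ c j, y r j := by
  rw [← coeff_ind_prod_gen (fun j C => ∏ r ∈ C, y r j)]
  have : ∀ (s : Finset J) (B : Finset ι), ∏ r ∈ B, ∑ j ∈ s, y r j =
      coeff (ind B) (∏ j ∈ s, gen fun C => ∏ r ∈ C, y r j) := fun s => by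
    induction s using Finset.induction_on with
    | empty =>
      intro B
      rcases B.eq_empty_or_nonempty with rfl | ⟨b, hb⟩
      · simp [ind]
      · have h0 : (0 : ι →₀ ℕ) ≠ ind B := fun h => by
          have := DFunLike.congr_fun h b
          simp [ind_apply, hb] at this
        rw [Finset.prod_empty, coeff_one, if_neg h0]
        exact Finset.prod_eq_zero hb (by simp)
    | insert a s ha ih =>
      intro B
      rw [Finset.prod_insert ha, coeff_ind_mul]
      simp only [Finset.sum_insert ha, Finset.prod_add, coeff_gen, ← ih]
  exact this Finset.univ B

end SquarefreeCoeff

/-! ### Order of vanishing, used to control truncation errors. -/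

section OrderAtLeast

variable {ι R : Type*} [DecidableEq ι] [CommRing R]

/-- The polynomials without terms of degree less than `n`. -/
def VanishesBelow (n : ℕ) (p : MvPolynomial ι R) : Prop := ∀ d : ι →₀ ℕ, d.degree < n → coeff d p = 0

theorem VanishesBelow.mul {a b : ℕ} {p q : MvPolynomial ι R} (hp : VanishesBelow a p)
    (hq : VanishesBelow b q) : VanishesBelow (a + b) (p * q) := fun d hd => by
  rw [coeff_mul]
  refine Finset.sum_eq_zero fun u hu => ?_
  rw [Finset.HasAntidiagonal.mem_antidiagonal] at hu
  have : u.1.degree + u.2.degree < a + b := by rwa [← map_add, hu]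
  rcases lt_or_ge u.1.degree a with h | h
  · rw [hp _ h, zero_mul]
  · rw [hq _ (by omega), mul_zero]

theorem VanishesBelow.sum {J : Type*} {n : ℕ} (s : Finset J) {p : J → MvPolynomial ι R}
    (hp : ∀ j ∈ s, VanishesBelow n (p j)) : VanishesBelow n (∑ j ∈ s, p j) := fun d hd => by
  rw [coeff_sum]
  exact Finset.sum_eq_zero fun j hj => hp j hj d hd

theorem vanishesBelow_zero (p : MvPolynomial ι R) : VanishesBelow 0 p := fun _ h => by omega

theorem vanishesBelow_pow {n : Type*} [Fintype n] [DecidableEq n]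
    (A : Matrix n n (MvPolynomial ι R)) (hA : ∀ i j, VanishesBelow 1 (A i j)) (p : ℕ) :
    ∀ i j, VanishesBelow p ((A ^ p) i j) := by
  induction p with
  | zero => exact fun i j => vanishesBelow_zero _
  | succ p ih =>
    intro i j
    rw [pow_succ, Matrix.mul_apply]
    exact VanishesBelow.sum _ fun x _ => (ih i x).mul (hA x j)

end OrderAtLeast

/-! ### The truncated logarithm of a determinant and its recursion. -/

section LogDet

variable {ι n : Type*} [DecidableEq ι] [Fintype n] [DecidableEq n]

/-- The truncation of `log det (1 + A) = ∑_p (-1)^(p-1) / p * tr (A^p)` at `p = l`. -/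
def logDet (l : ℕ) (A : Matrix n n (MvPolynomial ι ℝ)) : MvPolynomial ι ℝ :=
  ∑ p ∈ Finset.range (l + 1), C ((-1 : ℝ) ^ (p - 1) / p) * (A ^ p).trace

/-- The factor `p` from differentiating `tr (A ^ p)` cancels the denominator, which leaves a
truncated Neumann series for `(1 + A)⁻¹`. -/
theorem pderiv_logDet (l : ℕ) (A : Matrix n n (MvPolynomial ι ℝ)) (r : ι) :
    pderiv r (logDet l A) =
      ((∑ p ∈ Finset.range l, (-A) ^ p) * A.map (pderiv r)).trace := by
  rw [logDet, map_sum, Finset.sum_range_succ', Finset.sum_mul, Matrix.trace_sum]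
  -- The summand `p = 0` is harmless: its coefficient is `1 / 0 = 0`.
  have h0 : pderiv r (C ((-1 : ℝ) ^ (0 - 1) / (0 : ℕ)) * (A ^ 0).trace) = 0 := by simp
  rw [h0, add_zero]
  refine Finset.sum_congr rfl fun p _ => ?_
  rw [pderiv_C_mul, derivation_trace_pow, Nat.add_sub_cancel, ← mul_assoc, ← C_eq_coe_nat,
    ← C_mul, div_mul_cancel₀ _ (by positivity), neg_pow A, map_pow, map_neg, map_one]
  have : ((-1 : Matrix n n (MvPolynomial ι ℝ)) ^ p) =
      ((-1 : MvPolynomial ι ℝ) ^ p) • (1 : Matrix n n (MvPolynomial ι ℝ)) := by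
    rcases Nat.even_or_odd p with h | h
    · rw [h.neg_one_pow, h.neg_one_pow, one_smul]
    · rw [h.neg_one_pow, h.neg_one_pow, neg_smul, one_smul]
  rw [this, smul_mul_assoc, one_mul, smul_mul_assoc, Matrix.trace_smul, smul_eq_mul]

/-- The recursion between the coefficients of `det (1 + A)` (moments) and those of its logarithm
(cumulants). -/
theorem coeff_det_one_add (l : ℕ) (A : Matrix n n (MvPolynomial ι ℝ))
    (hA : ∀ i j, VanishesBelow 1 (A i j)) {r : ι} {B : Finset ι} (hr : r ∉ B) (hB : B.card < l) :
    coeff (ind (insert r B)) (1 + A).det =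
      ∑ C ∈ B.powerset, coeff (ind (insert r C)) (logDet l A) *
        coeff (ind (B \ C)) (1 + A).det := by
  have hd : (1 + A).map (pderiv r) = A.map (pderiv r) := by
    ext i j
    rcases eq_or_ne i j with rfl | hij <;> simp [*]
  have hgeom : (∑ p ∈ Finset.range l, (-A) ^ p) * (1 + A) = 1 - (-A) ^ l := by
    have := geom_sum_mul_neg (-A) l
    rwa [sub_neg_eq_add] at this
  -- Multiplying by the adjugate replaces the inverse of `1 + A`, up to an error containing `(-A) ^
  -- l`.
  have hadj : (1 + A).det • (∑ p ∈ Finset.range l, (-A) ^ p) =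
      (1 + A).adjugate - (-A) ^ l * (1 + A).adjugate := by
    have h2 := congrArg (· * (1 + A).adjugate) hgeom
    simp only [sub_mul, one_mul] at h2
    rw [← h2, mul_assoc, Matrix.mul_adjugate, mul_smul_comm, mul_one]
  have key : pderiv r (logDet l A) * (1 + A).det = pderiv r (1 + A).det -
      ((-A) ^ l * ((1 + A).adjugate * A.map (pderiv r))).trace := by
    rw [derivation_det, hd, pderiv_logDet, mul_comm, ← smul_eq_mul, ← Matrix.trace_smul,
      ← smul_mul_assoc, hadj, sub_mul, Matrix.trace_sub, mul_assoc]
  -- The entries of `(-A) ^ l` start in degree `l > |B|`, so the truncation does not affect this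
  -- coefficient.
  have herr : coeff (ind B) ((-A) ^ l * ((1 + A).adjugate * A.map (pderiv r))).trace = 0 := by
    have hn : ∀ i j, VanishesBelow 1 ((-A) i j) := fun i j d hd => by
      rw [Matrix.neg_apply, coeff_neg, hA i j d hd, neg_zero]
    have : VanishesBelow l ((-A) ^ l * ((1 + A).adjugate * A.map (pderiv r))).trace := by
      refine VanishesBelow.sum _ fun i _ => ?_
      rw [Matrix.diag_apply, Matrix.mul_apply]
      refine VanishesBelow.sum _ fun j _ => ?_
      exact (vanishesBelow_pow _ hn l i j).mul (vanishesBelow_zero _)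
    exact this _ (by rwa [degree_ind])
  have h3 := congrArg (coeff (ind B)) key
  rw [coeff_sub, herr, sub_zero, coeff_ind_pderiv _ hr, coeff_ind_mul] at h3
  rw [← h3]
  refine Finset.sum_congr rfl fun C hC => ?_
  rw [coeff_ind_pderiv _ fun h => hr (Finset.mem_powerset.1 hC h)]

end LogDet

/-! ### Matrix powers as sums over walks and cycles. -/

section TracePow

variable {n R : Type*} [Fintype n] [DecidableEq n] [CommRing R]

/-- The arbitrary weight `g` of the two endpoints serves the induction, which hides the last edge in
it. With `g i j = A j i` the walk is closed to a cycle. -/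
theorem sum_walks (A : Matrix n n R) (p : ℕ) (g : n → n → R) :
    ∑ k : Fin (p + 1) → n, (∏ j : Fin p, A (k j.castSucc) (k j.succ)) * g (k 0) (k (Fin.last p)) =
      ∑ i, ∑ j, (A ^ p) i j * g i j := by
  induction p generalizing g with
  | zero =>
    rw [← (Equiv.funUnique (Fin 1) n).symm.sum_comp]
    simp [Matrix.one_apply]
  | succ p ih =>
    rw [← (Fin.snocEquiv fun _ : Fin (p + 2) => n).sum_comp, Fintype.sum_prod_type]
    simp only [Fin.snocEquiv_apply]
    have h1 : ∀ (x : n) (k : Fin (p + 1) → n),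
        (∏ j : Fin (p + 1), A (Fin.snoc (α := fun _ => n) k x j.castSucc)
          (Fin.snoc (α := fun _ => n) k x j.succ)) *
          g (Fin.snoc (α := fun _ => n) k x 0) (Fin.snoc (α := fun _ => n) k x (Fin.last (p + 1))) =
        (∏ j : Fin p, A (k j.castSucc) (k j.succ)) *
          (A (k (Fin.last p)) x * g (k 0) x) := by
      intro x k
      have h0 : (0 : Fin (p + 2)) = Fin.castSucc (0 : Fin (p + 1)) := rfl
      rw [Fin.prod_univ_castSucc, h0, Fin.snoc_castSucc, Fin.snoc_last, Fin.snoc_castSucc,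
        Fin.succ_last, Fin.snoc_last, mul_assoc]
      congr 1
      refine Finset.prod_congr rfl fun j _ => ?_
      rw [Fin.snoc_castSucc, Fin.succ_castSucc, Fin.snoc_castSucc]
    simp only [h1]
    have h2 := fun x => ih fun i j => A j x * g i x
    simp only [h2]
    rw [Finset.sum_comm]
    refine Finset.sum_congr rfl fun i _ => ?_
    refine Finset.sum_congr rfl fun j _ => ?_
    rw [pow_succ, Matrix.mul_apply, Finset.sum_mul]
    exact Finset.sum_congr rfl fun x _ => by ring

theorem trace_pow_eq_sum_cycles (A : Matrix n n R) (p : ℕ) (hp : p ≠ 0) :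
    (A ^ p).trace = ∑ k : Fin p → n, ∏ j, A (k j) (k (finRotate p j)) := by
  obtain ⟨p, rfl⟩ := Nat.exists_eq_succ_of_ne_zero hp
  have := sum_walks A p fun i j => A j i
  rw [pow_succ, Matrix.trace]
  simp only [Matrix.diag_apply, Matrix.mul_apply]
  rw [← this]
  refine Finset.sum_congr rfl fun k _ => ?_
  rw [Fin.prod_univ_castSucc]
  congr 1
  · refine Finset.prod_congr rfl fun j _ => ?_
    rw [finRotate_apply, Fin.coeSucc_eq_succ]
  · rw [finRotate_last]

end TracePow


/-! ### Set partitions and the moment-cumulant recursion. -/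

section Cumulants

variable {ι : Type*} [DecidableEq ι]

/-- The set partitions of `B` as sets of sets. -/
def setPartitions (B : Finset ι) : Finset (Finset (Finset ι)) :=
  (Finset.univ : Finset (Finpartition B)).image Finpartition.parts

theorem mem_setPartitions {B : Finset ι} {P : Finset (Finset ι)} :
    P ∈ setPartitions B ↔ ∅ ∉ P ∧ (∀ p ∈ P, ∀ q ∈ P, ∀ i ∈ p, i ∈ q → p = q) ∧
      ∀ i, i ∈ B ↔ ∃ p ∈ P, i ∈ p := by
  rw [setPartitions, Finset.mem_image]
  constructor
  · rintro ⟨Q, -, rfl⟩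
    refine ⟨Q.empty_notMem_parts, fun p hp q hq i hi hi' => Q.eq_of_mem_parts hp hq hi hi',
      fun i => ?_⟩
    conv_lhs => rw [← Q.biUnion_parts]
    simp
  · rintro ⟨h1, h2, h3⟩
    refine ⟨⟨P, ?_, ?_, h1⟩, Finset.mem_univ _, rfl⟩
    · rw [Finset.supIndep_iff_pairwiseDisjoint]
      intro p hp q hq hpq
      rw [Function.onFun, id, id, Finset.disjoint_left]
      exact fun i hi hi' => hpq (h2 p hp q hq i hi hi')
    · ext i
      rw [h3]
      simp [Finset.mem_sup]

theorem sum_finpartition_eq (B : Finset ι) (F : Finset (Finset ι) → ℝ) :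
    ∑ P : Finpartition B, F P.parts = ∑ P ∈ setPartitions B, F P := by
  rw [setPartitions, Finset.sum_image]
  exact fun P _ Q _ h => Finpartition.ext h

/-- The combination of joint moments `m` that is the joint cumulant of the variables in `B`. -/
def partitionCumulant (m : Finset ι → ℝ) (B : Finset ι) : ℝ :=
  ∑ P : Finpartition B, (-1) ^ (P.parts.card - 1) * ((P.parts.card - 1).factorial : ℝ) *
      ∏ C ∈ P.parts, m C

theorem setPartitions_card_one {B : Finset ι} {P : Finset (Finset ι)} (hB : B.Nonempty) :
    (P ∈ setPartitions B ∧ P.card = 1) ↔ P = {B} := by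
  constructor
  · rintro ⟨h, h1⟩
    obtain ⟨p, rfl⟩ := Finset.card_eq_one.1 h1
    rw [mem_setPartitions] at h
    congr 1
    ext i
    simp [h.2.2 i]
  · rintro rfl
    refine ⟨mem_setPartitions.2 ⟨?_, ?_, ?_⟩, Finset.card_singleton _⟩
    · simpa using hB.ne_empty.symm
    · simp
    · simp

theorem card_filter_notMem_setPartitions {B : Finset ι} {P : Finset (Finset ι)} {r : ι}
    (hP : P ∈ setPartitions B) (hr : r ∈ B) : (P.filter (r ∉ ·)).card = P.card - 1 := by
  rw [mem_setPartitions] at hP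
  obtain ⟨p, hp, hrp⟩ := (hP.2.2 r).1 hr
  have : P.filter (r ∉ ·) = P.erase p := by
    ext q
    rw [Finset.mem_filter, Finset.mem_erase]
    constructor
    · rintro ⟨hq, h⟩
      exact ⟨fun h' => h (h' ▸ hrp), hq⟩
    · rintro ⟨h, hq⟩
      exact ⟨hq, fun h' => h (hP.2.1 q hq p hp r h' hrp)⟩
  rw [this, Finset.card_erase_of_mem hp]

/-- Removing a block that does not contain `r` from a partition of `insert r B`. -/
theorem sum_remove_block (F : Finset (Finset ι) → Finset ι → ℝ) {r : ι} {B : Finset ι}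
    (hr : r ∉ B) :
    ∑ C ∈ B.powerset.erase B, ∑ Q ∈ setPartitions (insert r C), F Q (B \ C) =
      ∑ P ∈ setPartitions (insert r B), ∑ p ∈ P with r ∉ p, F (P.erase p) p := by
  rw [Finset.sum_sigma', Finset.sum_sigma']
  have key : ∀ C ∈ B.powerset.erase B, ∀ Q ∈ setPartitions (insert r C), B \ C ∉ Q := by
    intro C hC Q hQ h
    rw [Finset.mem_erase, Finset.mem_powerset] at hC
    rw [mem_setPartitions] at hQ
    have hne : B \ C ≠ ∅ := fun h0 => hC.1 (hC.2.antisymm (Finset.sdiff_eq_empty_iff_subset.1 h0))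
    obtain ⟨i, hi⟩ := Finset.nonempty_iff_ne_empty.2 hne
    have := (hQ.2.2 i).2 ⟨_, h, hi⟩
    grind
  -- The removed block is the complement `B \ C`, non-empty because `C ≠ B`; the block containing
  -- `r` is never removed.
  refine Finset.sum_bij' (fun x _ => ⟨insert (B \ x.1) x.2, B \ x.1⟩)
    (fun y _ => ⟨B \ y.2, y.1.erase y.2⟩) ?_ ?_ ?_ ?_ ?_
  · rintro ⟨C, Q⟩ h
    rw [Finset.mem_sigma] at h
    obtain ⟨hC, hQ⟩ := h
    dsimp only at hC hQ
    rw [Finset.mem_erase, Finset.mem_powerset] at hC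
    rw [mem_setPartitions] at hQ
    obtain ⟨h1, h2, h3⟩ := hQ
    have hne : B \ C ≠ ∅ := fun h0 => hC.1 (hC.2.antisymm (Finset.sdiff_eq_empty_iff_subset.1 h0))
    rw [Finset.mem_sigma, mem_setPartitions]
    refine ⟨⟨?_, ?_, ?_⟩, ?_⟩
    · rw [Finset.mem_insert]
      rintro (h | h)
      exacts [hne h.symm, h1 h]
    · intro p hp q hq i hi hi'
      have hA : ∀ p ∈ Q, ∀ i ∈ p, i ∉ B \ C := fun p hp i hi hn => by
        have := (h3 i).2 ⟨p, hp, hi⟩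
        grind
      rw [Finset.mem_insert] at hp hq
      rcases hp with rfl | hp <;> rcases hq with rfl | hq
      · rfl
      · exact (hA q hq i hi' hi).elim
      · exact (hA p hp i hi hi').elim
      · exact h2 p hp q hq i hi hi'
    · intro i
      have h3i := h3 i
      have := @hC.2 i
      constructor
      · intro hi
        by_cases hiC : i ∈ insert r C
        · obtain ⟨p, hp, hip⟩ := h3i.1 hiC
          exact ⟨p, Finset.mem_insert_of_mem hp, hip⟩
        · exact ⟨B \ C, Finset.mem_insert_self _ _, by grind⟩
      · rintro ⟨p, hp, hip⟩
        rw [Finset.mem_insert] at hp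
        rcases hp with rfl | hp
        · grind
        · have := h3i.2 ⟨p, hp, hip⟩
          grind
    · rw [Finset.mem_filter]
      exact ⟨Finset.mem_insert_self _ _, fun h => hr (Finset.mem_sdiff.1 h).1⟩
  · rintro ⟨P, p⟩ h
    rw [Finset.mem_sigma, Finset.mem_filter] at h
    obtain ⟨hP, hp, hrp⟩ := h
    dsimp only at hP hp hrp
    rw [mem_setPartitions] at hP
    obtain ⟨h1, h2, h3⟩ := hP
    have hpB : p ⊆ B := fun i hi => by
      have := (h3 i).2 ⟨p, hp, hi⟩
      grind
    have hpn : p.Nonempty := Finset.nonempty_iff_ne_empty.2 fun h => h1 (h ▸ hp)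
    rw [Finset.mem_sigma, mem_setPartitions]
    dsimp only
    refine ⟨?_, ?_, ?_, ?_⟩
    · rw [Finset.mem_erase, Finset.mem_powerset]
      refine ⟨fun h => ?_, Finset.sdiff_subset⟩
      obtain ⟨i, hi⟩ := hpn
      have := hpB hi
      rw [← h] at this
      exact (Finset.mem_sdiff.1 this).2 hi
    · exact fun h => h1 (Finset.mem_of_mem_erase h)
    · exact fun q hq q' hq' => h2 q (Finset.mem_of_mem_erase hq) q' (Finset.mem_of_mem_erase hq')
    · intro i
      constructor
      · intro hi
        have hi' : i ∈ insert r B := by grind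
        obtain ⟨q, hq, hiq⟩ := (h3 i).1 hi'
        refine ⟨q, Finset.mem_erase.2 ⟨?_, hq⟩, hiq⟩
        rintro rfl
        grind
      · rintro ⟨q, hq, hiq⟩
        rw [Finset.mem_erase] at hq
        have h4 := (h3 i).2 ⟨q, hq.2, hiq⟩
        have h5 : i ∉ p := fun hip => hq.1 (h2 q hq.2 p hp i hiq hip)
        grind
  · rintro ⟨C, Q⟩ h
    rw [Finset.mem_sigma] at h
    have h2 := key C h.1 Q h.2
    have hC := Finset.mem_powerset.1 (Finset.mem_of_mem_erase h.1)
    dsimp only at hC h2 ⊢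
    rw [Finset.erase_insert h2, Finset.sdiff_sdiff_eq_self hC]
  · rintro ⟨P, p⟩ h
    rw [Finset.mem_sigma, Finset.mem_filter] at h
    obtain ⟨hP, hp, hrp⟩ := h
    dsimp only at hP hp hrp ⊢
    rw [mem_setPartitions] at hP
    have hpB : p ⊆ B := fun i hi => by
      have := (hP.2.2 i).2 ⟨p, hp, hi⟩
      grind
    rw [Finset.sdiff_sdiff_eq_self hpB, Finset.insert_erase hp]
  · rintro ⟨C, Q⟩ h
    rw [Finset.mem_sigma] at h
    dsimp only
    rw [Finset.erase_insert (key C h.1 Q h.2)]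

/-- The recursion between moments and cumulants for the partition formula. -/
theorem partitionCumulant_recursion (m : Finset ι → ℝ) (h0 : m ∅ = 1) {r : ι} {B : Finset ι}
    (hr : r ∉ B) :
    m (insert r B) = ∑ C ∈ B.powerset, partitionCumulant m (insert r C) * m (B \ C) := by
  set w : ℕ → ℝ := fun k => (-1) ^ (k - 1) * ((k - 1).factorial : ℝ) with hw
  have hpc : ∀ B, partitionCumulant m B = ∑ P ∈ setPartitions B, w P.card * ∏ C ∈ P, m C :=
    fun B => sum_finpartition_eq B fun P => w P.card * ∏ C ∈ P, m C
  rw [← Finset.add_sum_erase _ _ (Finset.mem_powerset_self B), Finset.sdiff_self, h0, mul_one]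
  simp only [hpc, Finset.sum_mul]
  have h2 := sum_remove_block (fun Q p => w Q.card * (∏ C ∈ Q, m C) * m p) hr
  rw [h2, ← Finset.sum_add_distrib]
  -- A partition with `n` blocks arises once directly and `n - 1` times by adding a block without
  -- `r`. Since `w n + (n - 1) w (n - 1) = 0` for `n ≥ 2`, only the one-block partition survives.
  have h3 : ∀ P ∈ setPartitions (insert r B), w P.card * ∏ C ∈ P, m C +
      ∑ p ∈ P with r ∉ p, w (P.erase p).card * (∏ C ∈ P.erase p, m C) * m p =
      if P.card = 1 then ∏ C ∈ P, m C else 0 := by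
    intro P hP
    have h4 : ∀ p ∈ P.filter (r ∉ ·), w (P.erase p).card * (∏ C ∈ P.erase p, m C) * m p =
        w (P.card - 1) * ∏ C ∈ P, m C := fun p hp => by
      have hp' := (Finset.mem_filter.1 hp).1
      rw [Finset.card_erase_of_mem hp', mul_assoc, Finset.prod_erase_mul _ _ hp']
    rw [Finset.sum_congr rfl h4, Finset.sum_const,
      card_filter_notMem_setPartitions hP (Finset.mem_insert_self r B), nsmul_eq_mul,
      ← mul_assoc, ← add_mul]
    have hpos : P.card ≠ 0 := by
      intro hc
      rw [Finset.card_eq_zero] at hc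
      obtain ⟨p, hp, -⟩ := ((mem_setPartitions.1 hP).2.2 r).1 (Finset.mem_insert_self r B)
      simp [hc] at hp
    obtain ⟨k, hk⟩ := Nat.exists_eq_succ_of_ne_zero hpos
    rw [hk, hw]
    rcases k with _ | k
    · simp
    · simp only [Nat.succ_eq_add_one, Nat.add_sub_cancel, Nat.factorial_succ]
      rw [if_neg (by omega)]
      push_cast
      ring
  rw [Finset.sum_congr rfl h3, ← Finset.sum_filter]
  have h5 : (setPartitions (insert r B)).filter (fun P => P.card = 1) = {{insert r B}} := by
    ext P
    rw [Finset.mem_filter, setPartitions_card_one (Finset.insert_nonempty r B),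
      Finset.mem_singleton]
  rw [h5]
  simp

/-- Cumulants are determined by the moments through the recursion. -/
theorem cumulant_unique [LinearOrder ι] {m c c' : Finset ι → ℝ} (h0 : m ∅ = 1)
    (hc : ∀ B r, (∀ q ∈ B, q < r) →
      m (insert r B) = ∑ C ∈ B.powerset, c (insert r C) * m (B \ C))
    (hc' : ∀ B r, (∀ q ∈ B, q < r) →
      m (insert r B) = ∑ C ∈ B.powerset, c' (insert r C) * m (B \ C))
    {B : Finset ι} (hB : B.Nonempty) : c B = c' B := by
  have key : ∀ (B : Finset ι) (r : ι), (∀ q ∈ B, q < r) → c (insert r B) = c' (insert r B) := by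
    intro B
    induction B using Finset.strongInduction with
    | H B ih =>
      intro r hr
      have h := (hc B r hr).symm.trans (hc' B r hr)
      -- The term `C = B` has factor `m ∅ = 1`, so the recursion expresses `c (insert r B)` through
      -- proper subsets `C`.
      rw [← Finset.add_sum_erase _ _ (Finset.mem_powerset_self B),
        ← Finset.add_sum_erase _ _ (Finset.mem_powerset_self B), Finset.sdiff_self, h0,
        mul_one, mul_one] at h
      have h1 : ∀ C ∈ B.powerset.erase B, c (insert r C) * m (B \ C) =
          c' (insert r C) * m (B \ C) := fun C hC => by
        rw [Finset.mem_erase, Finset.mem_powerset] at hC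
        rw [ih C (hC.2.ssubset_of_ne hC.1) r fun q hq => hr q (hC.2 hq)]
      rw [Finset.sum_congr rfl h1] at h
      exact add_right_cancel h
  have hM := Finset.max'_mem B hB
  have := key (B.erase (B.max' hB)) (B.max' hB) fun q hq =>
    lt_of_le_of_ne (Finset.le_max' _ _ (Finset.mem_of_mem_erase hq)) (Finset.ne_of_mem_erase hq)
  convert this <;> exact (Finset.insert_erase hM).symm

end Cumulants

/-! ### Numbered set partitions versus ordered splittings. -/

section Numberings

variable {ι : Type*} [DecidableEq ι] [Fintype ι]

/-- Comparing exponents at `i` says that exactly one part contains `i`. -/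
theorem mem_splittings_univ {J : Type*} [Fintype J] [DecidableEq J] {c : J → Finset ι} :
    c ∈ splittings J Finset.univ ↔
      (∀ j j' i, i ∈ c j → i ∈ c j' → j = j') ∧ ∀ i, ∃ j, i ∈ c j := by
  have h1 : c ∈ splittings J Finset.univ ↔ ∀ i, (Finset.univ.filter (i ∈ c ·)).card = 1 := by
    rw [mem_splittings, DFunLike.ext_iff]
    refine forall_congr' fun i => ?_
    rw [Finsupp.finsetSum_apply]
    simp [ind_apply]
  rw [h1]
  simp only [Finset.card_eq_one, Finset.eq_singleton_iff_unique_mem, Finset.mem_filter,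
    Finset.mem_univ, true_and]
  constructor
  · intro h
    refine ⟨fun j j' i hj hj' => ?_, fun i => (h i).imp fun j hj => hj.1⟩
    obtain ⟨a, -, ha⟩ := h i
    rw [ha j hj, ha j' hj']
  · rintro ⟨h1, h2⟩ i
    obtain ⟨j, hj⟩ := h2 i
    exact ⟨j, hj, fun j' hj' => h1 j' j i hj' hj⟩

/-- The numbering of the blocks of a partition that is given by a permutation. -/
def numbering (P : Finpartition (Finset.univ : Finset ι)) (σ : Equiv.Perm (Fin P.parts.card)) :
    Fin P.parts.card → Finset ι := fun j => P.parts.equivFin.symm (σ.symm j)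

theorem image_numbering (P : Finpartition (Finset.univ : Finset ι))
    (σ : Equiv.Perm (Fin P.parts.card)) : Finset.univ.image (numbering P σ) = P.parts := by
  ext B
  simp only [Finset.mem_image, Finset.mem_univ, true_and, numbering]
  constructor
  · rintro ⟨j, rfl⟩
    exact (P.parts.equivFin.symm (σ.symm j)).2
  · intro hB
    exact ⟨σ (P.parts.equivFin ⟨B, hB⟩), by simp⟩

theorem numbering_injective (P : Finpartition (Finset.univ : Finset ι)) :
    Function.Injective (numbering P) := fun σ τ h => by
  have : σ.symm = τ.symm := by
    ext j
    have := congrFun h j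
    rw [numbering, numbering, ← Subtype.ext_iff] at this
    rw [P.parts.equivFin.symm.injective this]
  simpa using congrArg Equiv.symm this

/-- Sums over numbered set partitions. -/
theorem sum_numberings (F : (n : ℕ) → (Fin n → Finset ι) → ℝ) :
    ∑ P : Finpartition (Finset.univ : Finset ι), ∑ σ : Equiv.Perm (Fin P.parts.card),
      F P.parts.card (numbering P σ) =
    ∑ n ∈ Finset.range (Fintype.card ι + 1),
      ∑ c ∈ splittings (Fin n) (Finset.univ : Finset ι) with ∀ j, c j ≠ ∅, F n c := by
  rw [Finset.sum_sigma', Finset.sum_sigma']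
  refine Finset.sum_bij (fun x _ => ⟨x.1.parts.card, numbering x.1 x.2⟩) ?_ ?_ ?_ ?_
  · rintro ⟨P, σ⟩ -
    rw [Finset.mem_sigma, Finset.mem_range, Finset.mem_filter, mem_splittings_univ]
    refine ⟨Nat.lt_succ_of_le P.card_parts_le_card, ⟨fun j j' i hj hj' => ?_, fun i => ?_⟩,
      fun j => ?_⟩
    · have := P.eq_of_mem_parts (P.parts.equivFin.symm (σ.symm j)).2
        (P.parts.equivFin.symm (σ.symm j')).2 hj hj'
      rw [← Subtype.ext_iff] at this
      simpa using this
    · obtain ⟨B, hB, hi⟩ := P.exists_mem (Finset.mem_univ i)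
      rw [← image_numbering P σ, Finset.mem_image] at hB
      obtain ⟨j, -, rfl⟩ := hB
      exact ⟨j, hi⟩
    · exact P.ne_empty (P.parts.equivFin.symm (σ.symm j)).2
  · rintro ⟨P, σ⟩ - ⟨Q, τ⟩ - h
    have hpar : ∀ x y : (Σ n : ℕ, Fin n → Finset ι), x = y →
        Finset.univ.image x.2 = Finset.univ.image y.2 := fun x y h => h ▸ rfl
    have h1 := hpar _ _ h
    rw [image_numbering, image_numbering] at h1
    obtain rfl : P = Q := Finpartition.ext h1
    rw [Sigma.mk.injEq] at h
    have h2 : σ = τ := numbering_injective P (eq_of_heq h.2)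
    rw [h2]
  · rintro ⟨n, c⟩ h
    rw [Finset.mem_sigma, Finset.mem_filter, mem_splittings_univ] at h
    obtain ⟨-, ⟨h1, h2⟩, h3⟩ := h
    dsimp only at h1 h2 h3
    have hinj : Function.Injective c := fun j j' hjj => by
      obtain ⟨i, hi⟩ := Finset.nonempty_iff_ne_empty.2 (h3 j)
      exact h1 j j' i hi (hjj ▸ hi)
    have hmem : Finset.univ.image c ∈ setPartitions (Finset.univ : Finset ι) := by
      rw [mem_setPartitions]
      refine ⟨?_, ?_, ?_⟩
      · simpa using fun j => h3 j
      · simp only [Finset.mem_image, Finset.mem_univ, true_and]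
        rintro _ ⟨j, rfl⟩ _ ⟨j', rfl⟩ i hi hi'
        rw [h1 j j' i hi hi']
      · simpa using h2
    rw [setPartitions, Finset.mem_image] at hmem
    obtain ⟨P, -, hP⟩ := hmem
    have hn : P.parts.card = n := by
      rw [hP, Finset.card_image_of_injective _ hinj, Finset.card_univ, Fintype.card_fin]
    subst hn
    have hcm : ∀ j, c j ∈ P.parts := fun j => hP ▸ Finset.mem_image_of_mem c (Finset.mem_univ j)
    let e : Fin P.parts.card → Fin P.parts.card := fun j => P.parts.equivFin ⟨c j, hcm j⟩
    have he : Function.Injective e := fun j j' hjj => by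
      have := P.parts.equivFin.injective hjj
      exact hinj (Subtype.ext_iff.1 this)
    let τ := Equiv.ofBijective e (Finite.injective_iff_bijective.1 he)
    refine ⟨⟨P, τ.symm⟩, Finset.mem_sigma.2 ⟨Finset.mem_univ _, Finset.mem_univ _⟩, ?_⟩
    have : numbering P τ.symm = c := by
      ext1 j
      simp [numbering, τ, e]
    rw [this]
  · rintro ⟨P, σ⟩ -
    rfl

end Numberings


/-! ### Iterated directional derivatives within a set. -/

section MixedDerivatives

open scoped ContDiff

variable {E : Type*} [NormedAddCommGroup E] [NormedSpace ℝ E]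

/-- The derivative within `s` in the direction `v`. -/
def dirDeriv (s : Set E) (v : E) (f : E → ℝ) : E → ℝ := fun t => fderivWithin ℝ f s t v

theorem contDiffOn_dirDeriv {s : Set E} (hs : UniqueDiffOn ℝ s) (v : E) {f : E → ℝ}
    (hf : ContDiffOn ℝ ∞ f s) : ContDiffOn ℝ ∞ (dirDeriv s v f) s :=
  (hf.fderivWithin hs (m := ∞) (by simp)).clm_apply contDiffOn_const

theorem dirDeriv_congr {s : Set E} {v : E} {f g : E → ℝ} (h : Set.EqOn f g s) :
    Set.EqOn (dirDeriv s v f) (dirDeriv s v g) s := fun t ht => by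
  rw [dirDeriv, dirDeriv, fderivWithin_congr h (h ht)]

theorem contDiffOn_foldr_dirDeriv {s : Set E} (hs : UniqueDiffOn ℝ s) (L : List E) {f : E → ℝ}
    (hf : ContDiffOn ℝ ∞ f s) : ContDiffOn ℝ ∞ (L.foldr (dirDeriv s) f) s := by
  induction L with
  | nil => exact hf
  | cons v L ih => exact contDiffOn_dirDeriv hs v ih

/-- Evaluation at fixed vectors is linear and continuous, so it commutes with differentiation. The
first vector is the outermost derivative on both sides. -/
theorem iteratedFDerivWithin_eq_foldr {s : Set E} (hs : UniqueDiffOn ℝ s) {f : E → ℝ}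
    (hf : ContDiffOn ℝ ∞ f s) (n : ℕ) (v : Fin n → E) {t : E} (ht : t ∈ s) :
    iteratedFDerivWithin ℝ n f s t v = (List.ofFn v).foldr (dirDeriv s) f t := by
  induction n generalizing t with
  | zero => simp
  | succ n ih =>
    rw [iteratedFDerivWithin_succ_apply_left, List.ofFn_succ, List.foldr_cons, dirDeriv]
    have hd : DifferentiableWithinAt ℝ (iteratedFDerivWithin ℝ n f s) s t :=
      hf.differentiableOn_iteratedFDerivWithin (m := n) (by exact_mod_cast ENat.natCast_lt_top n) hs t ht
    have h1 : fderivWithin ℝ (fun y => iteratedFDerivWithin ℝ n f s y (Fin.tail v)) s t =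
        (ContinuousMultilinearMap.apply ℝ (fun _ : Fin n => E) ℝ (Fin.tail v)).comp
          (fderivWithin ℝ (iteratedFDerivWithin ℝ n f s) s t) :=
      ((ContinuousMultilinearMap.apply ℝ (fun _ : Fin n => E) ℝ
        (Fin.tail v)).hasFDerivAt.comp_hasFDerivWithinAt t hd.hasFDerivWithinAt).fderivWithin
          (hs t ht)
    have h2 : fderivWithin ℝ (fun y => iteratedFDerivWithin ℝ n f s y (Fin.tail v)) s t =
        fderivWithin ℝ ((List.ofFn fun i => v i.succ).foldr (dirDeriv s) f) s t :=
      fderivWithin_congr (fun y hy => ih _ hy) (ih _ ht)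
    rw [← h2, h1]
    rfl

end MixedDerivatives

/-! ### Leibniz rule and logarithms for mixed partial derivatives. -/

section PartialDerivatives

open scoped ContDiff

variable {ι : Type*} [Fintype ι] [LinearOrder ι]

/-- The mixed partial derivative within `s` with respect to the variables in `B`. -/
def mixedDeriv (s : Set (ι → ℝ)) (B : Finset ι) (f : (ι → ℝ) → ℝ) : (ι → ℝ) → ℝ :=
  B.sort.foldr (fun r => dirDeriv s (Pi.single r 1)) f

theorem mixedDeriv_empty (s : Set (ι → ℝ)) (f : (ι → ℝ) → ℝ) : mixedDeriv s ∅ f = f := by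
  simp [mixedDeriv]

theorem mixedDeriv_insert_min {s : Set (ι → ℝ)} {B : Finset ι} {q : ι} (hq : ∀ x ∈ B, q < x)
    (f : (ι → ℝ) → ℝ) :
    mixedDeriv s (insert q B) f = dirDeriv s (Pi.single q 1) (mixedDeriv s B f) := by
  rw [mixedDeriv, Finset.sort_insert _ (fun x hx => (hq x hx).le) fun h => (hq q h).false]
  rfl

/-- The largest index is differentiated first, that is innermost. Keeping the order fixed makes
symmetry of mixed derivatives within `s` unnecessary; it is the reason why the recursions are only
required for `r` above `B`. -/
theorem mixedDeriv_insert_max {s : Set (ι → ℝ)} {B : Finset ι} {r : ι} (hr : ∀ x ∈ B, x < r)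
    (f : (ι → ℝ) → ℝ) :
    mixedDeriv s (insert r B) f = mixedDeriv s B (dirDeriv s (Pi.single r 1) f) := by
  induction B using Finset.induction_on_min with
  | empty => rw [mixedDeriv_insert_min (by simp), mixedDeriv_empty, mixedDeriv_empty]
  | insert q B hq ih =>
    rw [Finset.insert_comm, mixedDeriv_insert_min, mixedDeriv_insert_min hq,
      ih fun x hx => hr x (Finset.mem_insert_of_mem hx)]
    intro x hx
    rcases Finset.mem_insert.1 hx with rfl | hx
    · exact hr q (Finset.mem_insert_self _ _)
    · exact hq x hx

theorem contDiffOn_mixedDeriv {s : Set (ι → ℝ)} (hs : UniqueDiffOn ℝ s) (B : Finset ι) {f : (ι → ℝ) → ℝ} (hf : ContDiffOn ℝ ∞ f s) :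
    ContDiffOn ℝ ∞ (mixedDeriv s B f) s := by
  have := contDiffOn_foldr_dirDeriv hs (B.sort.map fun r => (Pi.single r 1 : ι → ℝ)) hf
  rwa [List.foldr_map] at this

theorem mixedDeriv_mul {s : Set (ι → ℝ)} (hs : UniqueDiffOn ℝ s) (B : Finset ι) {u v : (ι → ℝ) → ℝ} (hu : ContDiffOn ℝ ∞ u s)
    (hv : ContDiffOn ℝ ∞ v s) {t : ι → ℝ} (ht : t ∈ s) :
    mixedDeriv s B (u * v) t =
      ∑ C ∈ B.powerset, mixedDeriv s C u t * mixedDeriv s (B \ C) v t := by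
  induction B using Finset.induction_on_min generalizing t with
  | empty => simp [mixedDeriv_empty]
  | insert q B hq ih =>
    have hqB : q ∉ B := fun h => (hq q h).false
    have hd : ∀ C {f : (ι → ℝ) → ℝ}, ContDiffOn ℝ ∞ f s →
        DifferentiableWithinAt ℝ (mixedDeriv s C f) s t := fun C f hf =>
      (contDiffOn_mixedDeriv hs C hf).differentiableOn (by simp) t ht
    have h1 : Set.EqOn (mixedDeriv s B (u * v))
        (fun t => ∑ C ∈ B.powerset, mixedDeriv s C u t * mixedDeriv s (B \ C) v t) s :=
      fun t ht => ih ht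
    rw [mixedDeriv_insert_min hq, dirDeriv_congr h1 ht, dirDeriv,
      fderivWithin_fun_sum (hs t ht) fun C _ => (hd C hu).fun_mul (hd (B \ C) hv),
      Finset.sum_powerset_insert hqB, ← Finset.sum_add_distrib, _root_.sum_apply]
    refine Finset.sum_congr rfl fun C hC => ?_
    have hCB := Finset.mem_powerset.1 hC
    rw [fderivWithin_fun_mul (hs t ht) (hd C hu) (hd (B \ C) hv),
      Finset.insert_sdiff_of_notMem _ fun h => hqB (hCB h), Finset.insert_sdiff_insert,
      Finset.sdiff_insert_of_notMem hqB,
      mixedDeriv_insert_min (B := C) fun x hx => hq x (hCB hx),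
      mixedDeriv_insert_min (B := B \ C) fun x hx => hq x (Finset.sdiff_subset hx)]
    simp only [add_apply, _root_.smul_apply, smul_eq_mul, dirDeriv]
    ring

theorem mixedDeriv_congr {s : Set (ι → ℝ)} (B : Finset ι) {f g : (ι → ℝ) → ℝ} (h : Set.EqOn f g s) :
    Set.EqOn (mixedDeriv s B f) (mixedDeriv s B g) s := by
  induction B using Finset.induction_on_min with
  | empty => simpa only [mixedDeriv_empty] using h
  | insert q B hq ih =>
    rw [mixedDeriv_insert_min hq, mixedDeriv_insert_min hq]
    exact dirDeriv_congr ih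

/-- The mixed derivatives of a function and of its logarithm satisfy the recursion between moments
and cumulants. -/
theorem mixedDeriv_log {s : Set (ι → ℝ)} (hs : UniqueDiffOn ℝ s) {M : (ι → ℝ) → ℝ} (hM : ContDiffOn ℝ ∞ M s) (h0 : ∀ t ∈ s, M t ≠ 0)
    {B : Finset ι} {r : ι} (hr : ∀ q ∈ B, q < r) {t : ι → ℝ} (ht : t ∈ s) :
    mixedDeriv s (insert r B) M t = ∑ C ∈ B.powerset,
      mixedDeriv s (insert r C) (fun t => Real.log (M t)) t * mixedDeriv s (B \ C) M t := by
  have hlog : ContDiffOn ℝ ∞ (fun t => Real.log (M t)) s := hM.log h0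
  -- This is `∂_r M = (∂_r log M) M`; the Leibniz rule over `B` then yields the recursion.
  have h1 : Set.EqOn (dirDeriv s (Pi.single r 1) M)
      (dirDeriv s (Pi.single r 1) (fun t => Real.log (M t)) * M) s := fun t ht => by
    have hd := hM.differentiableOn (by simp) t ht
    rw [Pi.mul_apply, dirDeriv, dirDeriv, fderivWithin.log hd (h0 t ht) (hs t ht)]
    simp only [_root_.smul_apply, smul_eq_mul]
    field_simp [h0 t ht]
  rw [mixedDeriv_insert_max hr, mixedDeriv_congr B h1 ht,
    mixedDeriv_mul hs B (contDiffOn_dirDeriv hs _ hlog) hM ht]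
  refine Finset.sum_congr rfl fun C hC => ?_
  rw [mixedDeriv_insert_max fun q hq => hr q (Finset.mem_powerset.1 hC hq)]

end PartialDerivatives

theorem iteratedFDerivWithin_eq_mixedDeriv {l : ℕ} {s : Set (Fin l → ℝ)} (hs : UniqueDiffOn ℝ s)
    {f : (Fin l → ℝ) → ℝ} (hf : ContDiffOn ℝ (⊤ : ℕ∞) f s) {t : Fin l → ℝ} (ht : t ∈ s) :
    iteratedFDerivWithin ℝ l f s t (fun r => Pi.single r 1) = mixedDeriv s Finset.univ f t := by
  rw [iteratedFDerivWithin_eq_foldr hs hf _ _ ht, mixedDeriv, Fin.sort_univ, List.ofFn_eq_map,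
    List.foldr_map]


/-! ### Differentiation under the integral sign within a set. -/

section ParametricIntegral

open Filter Topology

variable {Ω : Type*} [MeasurableSpace Ω] {μ : Measure Ω} {ι : Type*} [Fintype ι]

/-- The linear form with the given coefficients. -/
def linForm (c : ι → ℝ) : (ι → ℝ) →L[ℝ] ℝ := ∑ r, c r • ContinuousLinearMap.proj r

theorem linForm_apply (c v : ι → ℝ) : linForm c v = ∑ r, c r * v r := by
  simp [linForm, _root_.sum_apply]

/-- Differentiation under the integral sign within a set. -/
theorem hasFDerivWithinAt_integral_of_dominated {s : Set (ι → ℝ)} {x₀ : ι → ℝ} (hx₀ : x₀ ∈ s)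
    {F : (ι → ℝ) → Ω → ℝ} {g : ι → Ω → ℝ} {bound : Ω → ℝ}
    (hF_int : ∀ x ∈ s, Integrable (F x) μ) (hg_int : ∀ r, Integrable (g r) μ)
    (h_lip : ∀ ω, ∀ x ∈ s, |F x ω - F x₀ ω| ≤ bound ω * ‖x - x₀‖)
    (bound_nonneg : ∀ ω, 0 ≤ bound ω) (bound_int : Integrable bound μ)
    (h_diff : ∀ ω, HasFDerivWithinAt (F · ω) (linForm (g · ω)) s x₀) :
    HasFDerivWithinAt (fun x => ∫ ω, F x ω ∂μ) (linForm fun r => ∫ ω, g r ω ∂μ) s x₀ := by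
  have nneg : ∀ x, 0 ≤ ‖x - x₀‖⁻¹ := fun x ↦ inv_nonneg.mpr (norm_nonneg _)
  have hlin : ∀ x, Integrable (fun ω => ∑ r, g r ω * (x - x₀) r) μ := fun x =>
    integrable_finsetSum _ fun r _ => (hg_int r).mul_const _
  have h1 : ∀ᶠ x in 𝓝[s] x₀, ‖x - x₀‖⁻¹ *
      ‖((∫ ω, F x ω ∂μ) - ∫ ω, F x₀ ω ∂μ) - (linForm fun r => ∫ ω, g r ω ∂μ) (x - x₀)‖ =
      ‖∫ ω, ‖x - x₀‖⁻¹ * (F x ω - F x₀ ω - ∑ r, g r ω * (x - x₀) r) ∂μ‖ := by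
    filter_upwards [self_mem_nhdsWithin] with x hx
    have hsub : Integrable (fun ω => F x ω - F x₀ ω) μ := (hF_int x hx).sub (hF_int _ hx₀)
    rw [integral_const_mul, integral_sub hsub (hlin x),
      integral_sub (hF_int x hx) (hF_int _ hx₀), integral_finsetSum _ fun r _ =>
        (hg_int r).mul_const _, norm_mul, norm_inv, norm_norm, linForm_apply]
    simp only [integral_mul_const]
  rw [hasFDerivWithinAt_iff_tendsto, tendsto_congr' h1, ← tendsto_zero_iff_norm_tendsto_zero, ←
    show (∫ _ω : Ω, (0 : ℝ) ∂μ) = 0 by simp]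
  -- The remainder divided by `‖x - x₀‖` is dominated by the Lipschitz bound plus the size of the
  -- candidate derivative.
  apply tendsto_integral_filter_of_dominated_convergence
    (bound := fun ω => bound ω + ∑ r, |g r ω|)
  · filter_upwards [self_mem_nhdsWithin] with x hx
    exact ((((hF_int x hx).sub (hF_int _ hx₀)).sub (hlin x)).const_mul _).aestronglyMeasurable
  · filter_upwards [self_mem_nhdsWithin] with x hx
    refine ae_of_all _ fun ω => ?_
    rw [norm_mul, norm_inv, norm_norm]
    rcases eq_or_ne x x₀ with rfl | hne
    · simpa using add_nonneg (bound_nonneg ω) (Finset.sum_nonneg fun r _ => abs_nonneg (g r ω))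
    have hpos : 0 < ‖x - x₀‖ := norm_pos_iff.2 (sub_ne_zero.2 hne)
    rw [inv_mul_le_iff₀ hpos]
    have h2 : |∑ r, g r ω * (x - x₀) r| ≤ (∑ r, |g r ω|) * ‖x - x₀‖ := by
      rw [Finset.sum_mul]
      refine (Finset.abs_sum_le_sum_abs _ _).trans (Finset.sum_le_sum fun r _ => ?_)
      rw [abs_mul]
      exact mul_le_mul_of_nonneg_left (norm_le_pi_norm (x - x₀) r) (abs_nonneg _)
    calc _ ≤ |F x ω - F x₀ ω| + |∑ r, g r ω * (x - x₀) r| := norm_sub_le _ _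
      _ ≤ bound ω * ‖x - x₀‖ + (∑ r, |g r ω|) * ‖x - x₀‖ := add_le_add (h_lip ω x hx) h2
      _ = ‖x - x₀‖ * (bound ω + ∑ r, |g r ω|) := by ring
  · exact bound_int.add (integrable_finsetSum _ fun r _ => (hg_int r).abs)
  · refine ae_of_all _ fun ω => ?_
    have h := h_diff ω
    rw [hasFDerivWithinAt_iff_tendsto] at h
    rw [tendsto_zero_iff_norm_tendsto_zero]
    refine h.congr fun x => ?_
    rw [norm_mul, norm_inv, norm_norm, linForm_apply]

end ParametricIntegral

/-- The convexity bound `e^y ≥ e^x (1 + y - x)`, used in both directions, replaces the mean value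
theorem. -/
theorem abs_exp_sub_exp_le (x y : ℝ) {w : ℝ} (hx : Real.exp x ≤ w) (hy : Real.exp y ≤ w) :
    |Real.exp x - Real.exp y| ≤ |x - y| * w := by
  have key : ∀ x y : ℝ, Real.exp x ≤ w → Real.exp x - Real.exp y ≤ |x - y| * w := fun x y hx => by
    have h1 : Real.exp y = Real.exp x * Real.exp (y - x) := by rw [← Real.exp_add]; ring_nf
    have h2 := Real.add_one_le_exp (y - x)
    have h3 := le_abs_self (x - y)
    have h4 := Real.exp_pos x
    have h5 := abs_nonneg (x - y)
    nlinarith [mul_le_mul_of_nonneg_left h2 h4.le, mul_le_mul_of_nonneg_left h3 h4.le,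
      mul_le_mul_of_nonneg_left hx h5]
  rw [abs_le]
  refine ⟨?_, key x y hx⟩
  have := key y x hy
  rw [abs_sub_comm] at this
  linarith

/-! ### Smoothness of exponential moments on the half-size box. -/

section ExponentialMoments

variable {Ω : Type*} [MeasurableSpace Ω] {μ : Measure Ω}

/-- The random variables with moments of all orders. -/
def AllMoments (μ : Measure Ω) (Y : Ω → ℝ) : Prop :=
  AEStronglyMeasurable Y μ ∧ ∀ p : ℕ, Integrable (fun ω => |Y ω| ^ p) μ

theorem AllMoments.mul {Y Z : Ω → ℝ} (hY : AllMoments μ Y) (hZ : AllMoments μ Z) :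
    AllMoments μ fun ω => Y ω * Z ω := by
  refine ⟨hY.1.mul hZ.1, fun p => ?_⟩
  refine ((hY.2 (2 * p)).add (hZ.2 (2 * p))).mono' ?_ (ae_of_all _ fun ω => ?_)
  · exact (continuous_abs.comp_aestronglyMeasurable (hY.1.mul hZ.1)).pow p
  · rw [Real.norm_eq_abs, abs_pow, abs_abs, abs_mul, mul_pow, Pi.add_apply, mul_comm 2 p, pow_mul,
      pow_mul]
    nlinarith [sq_nonneg (|Y ω| ^ p - |Z ω| ^ p), sq_nonneg (|Y ω| ^ p + |Z ω| ^ p)]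

theorem AllMoments.integrable_mul {Y W : Ω → ℝ} (hY : AllMoments μ Y)
    (hWm : AEStronglyMeasurable W μ) (hW : Integrable (fun ω => W ω ^ 2) μ) :
    Integrable (fun ω => Y ω * W ω) μ := by
  refine ((hY.2 2).add hW).mono' (hY.1.mul hWm) (ae_of_all _ fun ω => ?_)
  rw [Real.norm_eq_abs, abs_mul, Pi.add_apply, ← sq_abs (W ω)]
  nlinarith [sq_nonneg (|Y ω| - |W ω|), sq_nonneg (|Y ω| + |W ω|)]

variable {ι : Type*} [Fintype ι] [DecidableEq ι] {X : ι → Ω → ℝ} {a b : ι → ℝ}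

/-- A function that dominates `exp (∑ t_r X_r)` for all `t` in the box `∏ [a_r / 2, b_r / 2]`. -/
def expEnvelope (X : ι → Ω → ℝ) (a b : ι → ℝ) (ω : Ω) : ℝ :=
  ∏ r, (Real.exp (a r / 2 * X r ω) + Real.exp (b r / 2 * X r ω))

theorem exp_le_expEnvelope {t : ι → ℝ} (ht : t ∈ Set.Icc (fun r => a r / 2) fun r => b r / 2)
    (ω : Ω) : Real.exp (∑ r, t r * X r ω) ≤ expEnvelope X a b ω := by
  rw [Real.exp_sum]
  refine Finset.prod_le_prod (fun _ _ => (Real.exp_pos _).le) fun r _ => ?_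
  have h1 := ht.1 r
  have h2 := ht.2 r
  dsimp only at h1 h2
  rcases le_total 0 (X r ω) with h | h
  · have : Real.exp (t r * X r ω) ≤ Real.exp (b r / 2 * X r ω) :=
      Real.exp_le_exp.2 (mul_le_mul_of_nonneg_right h2 h)
    linarith [Real.exp_pos (a r / 2 * X r ω)]
  · have : Real.exp (t r * X r ω) ≤ Real.exp (a r / 2 * X r ω) :=
      Real.exp_le_exp.2 (mul_le_mul_of_nonpos_right h1 h)
    linarith [Real.exp_pos (b r / 2 * X r ω)]

theorem aestronglyMeasurable_exp_mul (hX : ∀ r, AEStronglyMeasurable (X r) μ) (c : ℝ) (r : ι) :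
    AEStronglyMeasurable (fun ω => Real.exp (c * X r ω)) μ :=
  Real.continuous_exp.comp_aestronglyMeasurable ((hX r).const_mul c)

theorem aestronglyMeasurable_expEnvelope (hX : ∀ r, AEStronglyMeasurable (X r) μ) :
    AEStronglyMeasurable (expEnvelope X a b) μ :=
  Finset.aestronglyMeasurable_fun_prod _ fun r _ =>
    (aestronglyMeasurable_exp_mul hX _ r).add (aestronglyMeasurable_exp_mul hX _ r)

/-- Squaring doubles the exponents, which is why the box is halved: `(u + v)² ≤ 2 (u² + v²)` in each
factor bounds the square by the exponentials at the vertices of `∏ [a_r, b_r]`. Square integrability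
then absorbs any factor with all moments. -/
theorem integrable_expEnvelope_sq (hX : ∀ r, AEStronglyMeasurable (X r) μ) (hab : a ≤ b)
    (hexp : ∀ t ∈ Set.Icc a b, Integrable (fun ω => Real.exp (∑ r, t r * X r ω)) μ) :
    Integrable (fun ω => expEnvelope X a b ω ^ 2) μ := by
  have h1 : Integrable (fun ω => ∑ S : Finset ι, 2 ^ Fintype.card ι *
      Real.exp (∑ r, (if r ∈ S then a r else b r) * X r ω)) μ := by
    refine integrable_finsetSum _ fun S _ => (hexp _ ⟨fun r => ?_, fun r => ?_⟩).const_mul _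
    · dsimp only
      split_ifs
      exacts [le_rfl, hab r]
    · dsimp only
      split_ifs
      exacts [hab r, le_rfl]
  refine h1.mono' ((aestronglyMeasurable_expEnvelope hX).pow 2) (ae_of_all _ fun ω => ?_)
  have h2 : ∑ S : Finset ι, 2 ^ Fintype.card ι *
      Real.exp (∑ r, (if r ∈ S then a r else b r) * X r ω) =
      ∏ r, 2 * (Real.exp (a r * X r ω) + Real.exp (b r * X r ω)) := by
    rw [Finset.prod_mul_distrib, Finset.prod_const, Finset.card_univ, Finset.prod_add,
      Finset.powerset_univ, ← Finset.mul_sum]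
    congr 1
    refine Finset.sum_congr rfl fun S _ => ?_
    rw [Real.exp_sum, ← Finset.prod_mul_prod_compl S, ← Finset.compl_eq_univ_sdiff]
    congr 1
    · exact Finset.prod_congr rfl fun r hr => by rw [if_pos hr]
    · exact Finset.prod_congr rfl fun r hr => by rw [if_neg (Finset.mem_compl.1 hr)]
  rw [Real.norm_eq_abs, abs_of_nonneg (sq_nonneg _), h2, expEnvelope, ← Finset.prod_pow]
  refine Finset.prod_le_prod (fun _ _ => sq_nonneg _) fun r _ => ?_
  have h3 : ∀ c : ℝ, Real.exp (c * X r ω) = Real.exp (c / 2 * X r ω) ^ 2 := fun c => by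
    rw [← Real.exp_nat_mul]
    congr 1
    push_cast
    ring
  rw [h3 (a r), h3 (b r)]
  nlinarith [sq_nonneg (Real.exp (a r / 2 * X r ω) - Real.exp (b r / 2 * X r ω))]

/-- The function `t ↦ E[Y exp (∑ t_r X_r)]`. -/
def expMoment (μ : Measure Ω) (X : ι → Ω → ℝ) (Y : Ω → ℝ) (t : ι → ℝ) : ℝ :=
  ∫ ω, Y ω * Real.exp (∑ r, t r * X r ω) ∂μ

theorem aestronglyMeasurable_exp_sum (hX : ∀ r, AEStronglyMeasurable (X r) μ) (t : ι → ℝ) :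
    AEStronglyMeasurable (fun ω => Real.exp (∑ r, t r * X r ω)) μ :=
  Real.continuous_exp.comp_aestronglyMeasurable
    (Finset.aestronglyMeasurable_fun_sum _ fun r _ => (hX r).const_mul _)

theorem integrable_mul_exp (hX : ∀ r, AEStronglyMeasurable (X r) μ)
    (hW : Integrable (fun ω => expEnvelope X a b ω ^ 2) μ) {Y : Ω → ℝ} (hY : AllMoments μ Y)
    {t : ι → ℝ} (ht : t ∈ Set.Icc (fun r => a r / 2) fun r => b r / 2) :
    Integrable (fun ω => Y ω * Real.exp (∑ r, t r * X r ω)) μ := by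
  refine hY.integrable_mul (aestronglyMeasurable_exp_sum hX t) ?_
  refine hW.mono' ((aestronglyMeasurable_exp_sum hX t).pow 2) (ae_of_all _ fun ω => ?_)
  rw [Real.norm_eq_abs, abs_of_nonneg (sq_nonneg _)]
  exact pow_le_pow_left₀ (Real.exp_pos _).le (exp_le_expEnvelope ht ω) 2

theorem hasFDerivAt_mul_exp_sum (x : ι → ℝ) (y : ℝ) (t : ι → ℝ) :
    HasFDerivAt (fun u : ι → ℝ => y * Real.exp (∑ r, u r * x r))
      (linForm fun r => x r * y * Real.exp (∑ r, t r * x r)) t := by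
  have h2 : HasFDerivAt (fun u : ι → ℝ => ∑ r, u r * x r)
      (∑ r, x r • (ContinuousLinearMap.proj r : (ι → ℝ) →L[ℝ] ℝ)) t :=
    HasFDerivAt.fun_sum fun r _ => (hasFDerivAt_apply r t).mul_const (x r)
  refine (h2.exp.const_mul y).congr_fderiv ?_
  rw [Finset.smul_sum, Finset.smul_sum, linForm]
  refine Finset.sum_congr rfl fun r _ => ?_
  rw [smul_smul, smul_smul]
  congr 1
  ring

theorem abs_mul_exp_sum_sub_le (x : ι → ℝ) (y : ℝ) (u t : ι → ℝ) {w : ℝ}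
    (hu : Real.exp (∑ r, u r * x r) ≤ w) (ht : Real.exp (∑ r, t r * x r) ≤ w) :
    |y * Real.exp (∑ r, u r * x r) - y * Real.exp (∑ r, t r * x r)| ≤
      (∑ r, |x r * y * w|) * ‖u - t‖ := by
  have h2 := abs_exp_sub_exp_le _ _ hu ht
  have hW0 : 0 ≤ w := (Real.exp_pos _).le.trans hu
  have h3 : |∑ r, u r * x r - ∑ r, t r * x r| ≤ ∑ r, |x r| * ‖u - t‖ := by
    rw [← Finset.sum_sub_distrib]
    refine (Finset.abs_sum_le_sum_abs _ _).trans (Finset.sum_le_sum fun r _ => ?_)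
    rw [← sub_mul, abs_mul, mul_comm]
    exact mul_le_mul_of_nonneg_left (norm_le_pi_norm (u - t) r) (abs_nonneg _)
  rw [← mul_sub, abs_mul]
  calc _ ≤ |y| * ((∑ r, |x r| * ‖u - t‖) * w) :=
        mul_le_mul_of_nonneg_left (h2.trans (mul_le_mul_of_nonneg_right h3 hW0)) (abs_nonneg _)
    _ = _ := by
        rw [Finset.sum_mul, Finset.mul_sum, Finset.sum_mul]
        refine Finset.sum_congr rfl fun r _ => ?_
        rw [abs_mul, abs_mul, abs_of_nonneg hW0]
        ring

theorem hasFDerivWithinAt_expMoment (hX : ∀ r, AllMoments μ (X r))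
    (hW : Integrable (fun ω => expEnvelope X a b ω ^ 2) μ) {Y : Ω → ℝ} (hY : AllMoments μ Y)
    {t : ι → ℝ} (ht : t ∈ Set.Icc (fun r => a r / 2) fun r => b r / 2) :
    HasFDerivWithinAt (expMoment μ X Y)
      (linForm fun r => expMoment μ X (fun ω => X r ω * Y ω) t)
      (Set.Icc (fun r => a r / 2) fun r => b r / 2) t := by
  have hXm := fun r => (hX r).1
  have hg : ∀ r, Integrable (fun ω => X r ω * Y ω * Real.exp (∑ r, t r * X r ω)) μ :=
    fun r => integrable_mul_exp hXm hW ((hX r).mul hY) ht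
  exact hasFDerivWithinAt_integral_of_dominated ht
    (F := fun t ω => Y ω * Real.exp (∑ r, t r * X r ω))
    (bound := fun ω => ∑ r, |X r ω * Y ω * expEnvelope X a b ω|)
    (fun u hu => integrable_mul_exp hXm hW hY hu) hg
    (fun ω u hu => abs_mul_exp_sum_sub_le _ _ _ _ (exp_le_expEnvelope hu ω)
      (exp_le_expEnvelope ht ω))
    (fun ω => Finset.sum_nonneg fun _ _ => abs_nonneg _)
    (integrable_finsetSum _ fun r _ => (((hX r).mul hY).integrable_mul
      (aestronglyMeasurable_expEnvelope hXm) hW).abs)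
    fun ω => (hasFDerivAt_mul_exp_sum _ _ t).hasFDerivWithinAt

theorem uniqueDiffOn_halfBox (hab : ∀ r, a r < b r) :
    UniqueDiffOn ℝ (Set.Icc (fun r => a r / 2) fun r => b r / 2) := by
  rw [← Set.pi_univ_Icc]
  exact UniqueDiffOn.univ_pi fun r => uniqueDiffOn_Icc (by linarith [hab r])

/-- Each derivative is a combination of functions of the same kind with `X r * Y` for `Y`, and these
products again have all moments, so induction on the order applies. -/
theorem contDiffOn_expMoment (hab : ∀ r, a r < b r) (hX : ∀ r, AllMoments μ (X r))
    (hW : Integrable (fun ω => expEnvelope X a b ω ^ 2) μ) {Y : Ω → ℝ} (hY : AllMoments μ Y) :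
    ContDiffOn ℝ (⊤ : ℕ∞) (expMoment μ X Y) (Set.Icc (fun r => a r / 2) fun r => b r / 2) := by
  rw [contDiffOn_infty]
  intro n
  induction n generalizing Y with
  | zero =>
    exact contDiffOn_zero.2 fun t ht => (hasFDerivWithinAt_expMoment hX hW hY ht).continuousWithinAt
  | succ n ih =>
    push_cast
    refine contDiffOn_succ_of_fderivWithin
      (fun t ht => (hasFDerivWithinAt_expMoment hX hW hY ht).differentiableWithinAt)
      (fun h => absurd h (WithTop.coe_ne_top)) ?_
    have h1 : ContDiffOn ℝ n (fun t => ∑ r, expMoment μ X (fun ω => X r ω * Y ω) t •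
        (ContinuousLinearMap.proj r : (ι → ℝ) →L[ℝ] ℝ))
        (Set.Icc (fun r => a r / 2) fun r => b r / 2) :=
      ContDiffOn.sum fun r _ => (ih ((hX r).mul hY)).smul contDiffOn_const
    exact h1.congr fun t ht => (hasFDerivWithinAt_expMoment hX hW hY ht).fderivWithin
      (uniqueDiffOn_halfBox hab t ht)

theorem mixedDeriv_expMoment {ι : Type*} [Fintype ι] [LinearOrder ι] {X : ι → Ω → ℝ}
    {a b : ι → ℝ} (hab : ∀ r, a r < b r) (hX : ∀ r, AllMoments μ (X r))
    (hW : Integrable (fun ω => expEnvelope X a b ω ^ 2) μ) (B : Finset ι) {Y : Ω → ℝ}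
    (hY : AllMoments μ Y) {t : ι → ℝ} (ht : t ∈ Set.Icc (fun r => a r / 2) fun r => b r / 2) :
    AllMoments μ (fun ω => (∏ r ∈ B, X r ω) * Y ω) ∧
    mixedDeriv (Set.Icc (fun r => a r / 2) fun r => b r / 2) B (expMoment μ X Y) t =
      expMoment μ X (fun ω => (∏ r ∈ B, X r ω) * Y ω) t := by
  induction B using Finset.induction_on_min generalizing t with
  | empty => simpa [mixedDeriv_empty] using hY
  | insert q B hq ih =>
    have hm := (ih ht).1
    have hqB : q ∉ B := fun h => (hq q h).false
    have he : (fun ω => (∏ r ∈ insert q B, X r ω) * Y ω) =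
        fun ω => X q ω * ((∏ r ∈ B, X r ω) * Y ω) := by
      ext ω
      rw [Finset.prod_insert hqB, mul_assoc]
    rw [he]
    refine ⟨(hX q).mul hm, ?_⟩
    rw [mixedDeriv_insert_min hq, dirDeriv_congr (fun u hu => (ih hu).2) ht, dirDeriv,
      (hasFDerivWithinAt_expMoment hX hW hm ht).fderivWithin (uniqueDiffOn_halfBox hab t ht),
      linForm_apply]
    simp [Pi.single_apply]

end ExponentialMoments

/-! ### Derivatives of the cumulant generating function. -/

section CumulantGeneratingFunction

open scoped Topology

variable {Ω : Type*} [MeasurableSpace Ω] {μ : Measure Ω} [IsProbabilityMeasure μ] {l : ℕ}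
  {X : Fin l → Ω → ℝ} {a b : Fin l → ℝ}

/-- The joint cumulant as the derivative of the cumulant generating function within a box agrees
with any solution of the recursion between moments and cumulants. -/
theorem iteratedFDerivWithin_jointCGF (hl : 1 ≤ l) (hab : ∀ r, a r ≤ 0 ∧ 0 ≤ b r ∧ a r < b r)
    (hX : ∀ r, AllMoments μ (X r))
    (hexp : ∀ t ∈ Set.Icc a b, Integrable (fun ω => Real.exp (∑ r, t r * X r ω)) μ)
    {c : Finset (Fin l) → ℝ}
    (hc : ∀ B r, (∀ q ∈ B, q < r) → ∫ ω, ∏ q ∈ insert r B, X q ω ∂μ =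
      ∑ C ∈ B.powerset, c (insert r C) * ∫ ω, ∏ q ∈ B \ C, X q ω ∂μ) :
    ContDiffWithinAt ℝ l (jointCGF μ X) (Set.Icc a b) 0 ∧
      iteratedFDerivWithin ℝ l (jointCGF μ X) (Set.Icc a b) 0 (fun r => Pi.single r 1) =
        c Finset.univ := by
  have hXm := fun r => (hX r).1
  have hW := integrable_expEnvelope_sq hXm (fun r => (hab r).2.2.le) hexp
  have hlt := fun r => (hab r).2.2
  set s : Set (Fin l → ℝ) := Set.Icc (fun r => a r / 2) fun r => b r / 2 with hs_def
  have hs : UniqueDiffOn ℝ s := uniqueDiffOn_halfBox hlt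
  have h1 : AllMoments μ (fun _ => (1 : ℝ)) := ⟨aestronglyMeasurable_const, fun p => by simp⟩
  have hM := contDiffOn_expMoment hlt hX hW h1
  have hpos : ∀ t ∈ s, expMoment μ X (fun _ => 1) t ≠ 0 := fun t ht => by
    have := integrable_mul_exp hXm hW h1 ht
    simp only [one_mul] at this
    simp only [expMoment, one_mul]
    exact (integral_exp_pos this).ne'
  have hcgf : jointCGF μ X = fun t => Real.log (expMoment μ X (fun _ => 1) t) := by
    ext t
    simp [jointCGF, expMoment]
  have hlog : ContDiffOn ℝ (⊤ : ℕ∞) (jointCGF μ X) s := hcgf ▸ hM.log hpos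
  have h0 : (0 : Fin l → ℝ) ∈ s :=
    ⟨fun r => by simpa using by linarith [(hab r).1], fun r => by simpa using by linarith [(hab r).2.1]⟩
  -- Near `0` the two boxes agree: an endpoint equal to `0` stays `0` when halved, and any other
  -- endpoint stays away from `0`.
  have hset : s =ᶠ[𝓝 0] Set.Icc a b := by
    have : ∀ᶠ t : Fin l → ℝ in 𝓝 0, ∀ r, (a r / 2 ≤ t r ∧ t r ≤ b r / 2 ↔ a r ≤ t r ∧ t r ≤ b r) := by
      rw [Filter.eventually_all]
      intro r
      have hcont : Filter.Tendsto (fun t : Fin l → ℝ => t r) (𝓝 0) (𝓝 0) :=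
        (continuous_apply r).tendsto' _ _ rfl
      have hA : ∀ᶠ x : ℝ in 𝓝 0, (a r / 2 ≤ x ↔ a r ≤ x) := by
        rcases (hab r).1.lt_or_eq with h | h
        · filter_upwards [lt_mem_nhds (show a r / 2 < 0 by linarith)] with x hx
          exact ⟨fun _ => by linarith, fun _ => hx.le⟩
        · simp [h]
      have hB : ∀ᶠ x : ℝ in 𝓝 0, (x ≤ b r / 2 ↔ x ≤ b r) := by
        rcases (hab r).2.1.lt_or_eq with h | h
        · filter_upwards [gt_mem_nhds (show 0 < b r / 2 by linarith)] with x hx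
          exact ⟨fun _ => by linarith, fun _ => hx.le⟩
        · simp [← h]
      filter_upwards [hcont.eventually hA, hcont.eventually hB] with t h1 h2
      rw [h1, h2]
    filter_upwards [this] with t ht
    refine propext ?_
    change t ∈ s ↔ t ∈ Set.Icc a b
    rw [hs_def, ← Set.pi_univ_Icc, ← Set.pi_univ_Icc]
    simpa only [Set.mem_pi, Set.mem_univ, true_imp_iff, Set.mem_Icc] using forall_congr' ht
  refine ⟨?_, ?_⟩
  · have := (hlog 0 h0).of_le (m := l) (by exact_mod_cast le_top)
    exact (contDiffWithinAt_congr_set hset).1 this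
  · rw [← iteratedFDerivWithin_congr_set hset, iteratedFDerivWithin_eq_mixedDeriv hs hlog h0]
    have hm : ∀ B : Finset (Fin l), mixedDeriv s B (expMoment μ X fun _ => 1) 0 =
        ∫ ω, ∏ r ∈ B, X r ω ∂μ := fun B => by
      rw [(mixedDeriv_expMoment hlt hX hW B h1 h0).2]
      simp [expMoment]
    refine cumulant_unique (m := fun B => ∫ ω, ∏ r ∈ B, X r ω ∂μ)
      (c := fun B => mixedDeriv s B (jointCGF μ X) 0) (by simp) (fun B r hr => ?_) hc
      ⟨⟨0, hl⟩, Finset.mem_univ _⟩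
    have := mixedDeriv_log hs hM hpos hr h0
    simp only [hm, ← hcgf] at this
    exact this

end CumulantGeneratingFunction


/-! ### Moments and cyclic integrals of a determinantal ensemble. -/

section DeterminantalEnsemble

variable {E : Type*} [MeasurableSpace E] {ν : Measure E} [SigmaFinite ν] {m : ℕ}
  {φ : Fin m → E → ℝ}

/-- The determinant `det (φ_k (x_i))`. -/
def slater (φ : Fin m → E → ℝ) (x : Fin m → E) : ℝ := (Matrix.of fun k i => φ k (x i)).det

theorem slater_sq (φ : Fin m → E → ℝ) (x : Fin m → E) : slater φ x ^ 2 =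
    ∑ τ : Equiv.Perm (Fin m), ∑ σ : Equiv.Perm (Fin m),
      ((Equiv.Perm.sign τ : ℤ) * (Equiv.Perm.sign σ : ℤ) : ℝ) *
        ∏ i, φ (σ i) (x i) * φ (τ i) (x i) := by
  rw [sq, slater, Matrix.det_apply', Finset.sum_mul_sum]
  refine Finset.sum_congr rfl fun τ _ => Finset.sum_congr rfl fun σ _ => ?_
  simp only [Matrix.of_apply, Finset.prod_mul_distrib]
  ring

/-- Andréief's integration formula. -/
theorem integral_prod_mul_slater_sq {h : Fin m → E → ℝ}
    (hint : ∀ i j k, Integrable (fun x => h i x * (φ j x * φ k x)) ν) :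
    Integrable (fun x => (∏ i, h i (x i)) * slater φ x ^ 2) (Measure.pi fun _ => ν) ∧
    ∫ x, (∏ i, h i (x i)) * slater φ x ^ 2 ∂(Measure.pi fun _ => ν) =
      ∑ τ : Equiv.Perm (Fin m), ∑ σ : Equiv.Perm (Fin m),
        ((Equiv.Perm.sign τ : ℤ) * (Equiv.Perm.sign σ : ℤ) : ℝ) *
          ∏ i, ∫ x, h i x * (φ (σ i) x * φ (τ i) x) ∂ν := by
  have he : (fun x : Fin m → E => (∏ i, h i (x i)) * slater φ x ^ 2) = fun x =>
      ∑ τ : Equiv.Perm (Fin m), ∑ σ : Equiv.Perm (Fin m),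
        ((Equiv.Perm.sign τ : ℤ) * (Equiv.Perm.sign σ : ℤ) : ℝ) *
          ∏ i, h i (x i) * (φ (σ i) (x i) * φ (τ i) (x i)) := by
    ext x
    rw [slater_sq, Finset.mul_sum]
    refine Finset.sum_congr rfl fun τ _ => ?_
    rw [Finset.mul_sum]
    refine Finset.sum_congr rfl fun σ _ => ?_
    rw [Finset.prod_mul_distrib (f := fun i => h i (x i))]
    ring
  have hi : ∀ τ σ : Equiv.Perm (Fin m), Integrable (fun x : Fin m → E =>
      ((Equiv.Perm.sign τ : ℤ) * (Equiv.Perm.sign σ : ℤ) : ℝ) *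
        ∏ i, h i (x i) * (φ (σ i) (x i) * φ (τ i) (x i))) (Measure.pi fun _ => ν) := fun τ σ =>
    (Integrable.fintype_prod (f := fun i y => h i y * (φ (σ i) y * φ (τ i) y))
      fun i => hint i _ _).const_mul _
  rw [he]
  refine ⟨integrable_finsetSum _ fun τ _ => integrable_finsetSum _ fun σ _ => hi τ σ, ?_⟩
  rw [integral_finsetSum _ fun τ _ => integrable_finsetSum _ fun σ _ => hi τ σ]
  refine Finset.sum_congr rfl fun τ _ => ?_
  rw [integral_finsetSum _ fun σ _ => hi τ σ]
  refine Finset.sum_congr rfl fun σ _ => ?_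
  rw [integral_const_mul,
    integral_fintype_prod_eq_prod (fun i y => h i y * (φ (σ i) y * φ (τ i) y))]

variable {ι : Type*} [DecidableEq ι] [Fintype ι] {f : ι → E → ℝ}

/-- The matrix of the multiplication by `∏_{r ∈ B} f_r`, compressed to the span of the `φ_k`. -/
def multMatrix (ν : Measure E) (φ : Fin m → E → ℝ) (f : ι → E → ℝ) (B : Finset ι) :
    Matrix (Fin m) (Fin m) ℝ := fun j k => ∫ x, (∏ r ∈ B, f r x) * (φ j x * φ k x) ∂ν

/-- The generating matrix `∑_B t_B a_B`, over the non-empty sets `B`, of the matrices `a_B` of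
multiplication by `∏_{r ∈ B} f_r`. -/
def genMatrix (ν : Measure E) (φ : Fin m → E → ℝ) (f : ι → E → ℝ) :
    Matrix (Fin m) (Fin m) (MvPolynomial ι ℝ) :=
  fun j k => gen fun B => if B = ∅ then 0 else multMatrix ν φ f B j k

theorem vanishesBelow_genMatrix (j k : Fin m) : VanishesBelow 1 (genMatrix ν φ f j k) := by
  intro d hd
  have hd0 : d = 0 := by
    rw [← Finsupp.degree_eq_zero_iff]
    omega
  have : d = ind ∅ := by simp [hd0, ind]
  rw [this, genMatrix, coeff_gen, if_pos rfl]

/-- By orthonormality the matrix of the empty product is the identity, which supplies the missing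
term `B = ∅`. -/
theorem one_add_genMatrix
    (horth : ∀ j k, ∫ x, φ j x * φ k x ∂ν = if j = k then 1 else 0) :
    1 + genMatrix ν φ f = fun j k => gen fun B => multMatrix ν φ f B j k := by
  ext1 j k
  rw [Matrix.add_apply, genMatrix, gen, gen,
    ← Finset.add_sum_erase _ _ (Finset.mem_univ (∅ : Finset ι)),
    ← Finset.add_sum_erase _ _ (Finset.mem_univ (∅ : Finset ι)), ← add_assoc]
  congr 1
  · have : multMatrix ν φ f ∅ j k = (1 : Matrix (Fin m) (Fin m) ℝ) j k := by
      simp [multMatrix, horth, Matrix.one_apply]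
    rw [this, if_pos rfl]
    rcases eq_or_ne j k with rfl | hjk
    · simp [ind]
    · simp [hjk]
  · refine Finset.sum_congr rfl fun B hB => ?_
    rw [if_neg (Finset.ne_of_mem_erase hB)]

/-- The integrals of products of linear statistics are the coefficients of a determinant. -/
theorem integral_prod_sum_mul_slater_sq
    (hint : ∀ (B : Finset ι) j k, Integrable (fun x => (∏ r ∈ B, f r x) * (φ j x * φ k x)) ν)
    (horth : ∀ j k, ∫ x, φ j x * φ k x ∂ν = if j = k then 1 else 0) (B : Finset ι) :
    Integrable (fun x => (∏ r ∈ B, ∑ i, f r (x i)) * slater φ x ^ 2) (Measure.pi fun _ => ν) ∧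
    ∫ x, (∏ r ∈ B, ∑ i, f r (x i)) * slater φ x ^ 2 ∂(Measure.pi fun _ => ν) =
      m.factorial * (1 + genMatrix ν φ f).det.coeff (ind B) := by
  have he : (fun x : Fin m → E => (∏ r ∈ B, ∑ i, f r (x i)) * slater φ x ^ 2) = fun x =>
      ∑ c ∈ splittings (Fin m) B, (∏ i, ∏ r ∈ c i, f r (x i)) * slater φ x ^ 2 := by
    ext x
    rw [prod_sum_eq_sum_splittings, Finset.sum_mul]
  have hA := fun c : Fin m → Finset ι => integral_prod_mul_slater_sq (φ := φ)
    (h := fun i x => ∏ r ∈ c i, f r x) fun i j k => hint (c i) j k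
  rw [he]
  refine ⟨integrable_finsetSum _ fun c _ => (hA c).1, ?_⟩
  rw [integral_finsetSum _ fun c _ => (hA c).1, one_add_genMatrix horth,
    Finset.sum_congr rfl fun c _ => (hA c).2, Finset.sum_comm]
  -- Permuting the columns by `τ` changes the determinant by `sign τ`, so every `τ` contributes the
  -- same determinant. This is the source of the factor `m!`.
  have key : ∀ τ : Equiv.Perm (Fin m), ∑ c ∈ splittings (Fin m) B, ∑ σ : Equiv.Perm (Fin m),
      ((Equiv.Perm.sign τ : ℤ) * (Equiv.Perm.sign σ : ℤ) : ℝ) *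
        ∏ i, ∫ x, (∏ r ∈ c i, f r x) * (φ (σ i) x * φ (τ i) x) ∂ν =
      (Matrix.det fun j k => gen fun B => multMatrix ν φ f B j k).coeff (ind B) := by
    intro τ
    set G : Matrix (Fin m) (Fin m) (MvPolynomial ι ℝ) :=
      fun j k => gen fun B => multMatrix ν φ f B j k with hG
    have h1 : G.det = (Equiv.Perm.sign τ : ℤ) * (G.submatrix id τ).det := by
      rw [Matrix.det_permute', ← mul_assoc, ← Int.cast_mul, ← Units.val_mul, Int.units_mul_self]
      simp
    rw [h1, Matrix.det_apply', Finset.mul_sum, MvPolynomial.coeff_sum, Finset.sum_comm]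
    refine Finset.sum_congr rfl fun σ _ => ?_
    rw [← mul_assoc, ← map_intCast (MvPolynomial.C (R := ℝ) (σ := ι)) (Equiv.Perm.sign τ : ℤ),
      ← map_intCast (MvPolynomial.C (R := ℝ) (σ := ι)) (Equiv.Perm.sign σ : ℤ), ← map_mul,
      MvPolynomial.coeff_C_mul]
    have h2 : ∏ i, G.submatrix id τ (σ i) i =
        ∏ i, gen fun B => multMatrix ν φ f B (σ i) (τ i) := rfl
    rw [h2, coeff_ind_prod_gen, Finset.mul_sum]
    rfl
  rw [Finset.sum_congr rfl fun τ _ => key τ, Finset.sum_const, Finset.card_univ,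
    Fintype.card_perm, Fintype.card_fin, nsmul_eq_mul]

/-- The correlation kernel of the span of the `φ_k`. -/
def projKernel (φ : Fin m → E → ℝ) (x y : E) : ℝ := ∑ k, φ k x * φ k y

/-- Expanding every kernel separates the variables: the integrand becomes a sum, over labels of the
edges of the cycle, of products of functions of one point. The resulting sum is a trace of a product
of matrices. -/
theorem integral_cyclic_projKernel {n : ℕ} {h : Fin n → E → ℝ}
    (hint : ∀ i j k, Integrable (fun x => h i x * (φ j x * φ k x)) ν) :
    Integrable (fun x : Fin n → E => ∏ j, h j (x j) * projKernel φ (x j) (x (finRotate n j)))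
      (Measure.pi fun _ => ν) ∧
    ∫ x : Fin n → E, ∏ j, h j (x j) * projKernel φ (x j) (x (finRotate n j))
        ∂(Measure.pi fun _ => ν) =
      ∑ k : Fin n → Fin m, ∏ j, ∫ x, h j x * (φ (k j) x * φ (k (finRotate n j)) x) ∂ν := by
  have he : (fun x : Fin n → E => ∏ j, h j (x j) * projKernel φ (x j) (x (finRotate n j))) =
      fun x => ∑ k : Fin n → Fin m,
        ∏ j, h j (x j) * (φ (k j) (x j) * φ (k (finRotate n j)) (x j)) := by
    ext x
    rw [Finset.prod_mul_distrib]
    simp only [projKernel]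
    -- The labels are rotated so that the edge from `j` to `j + 1` carries `k (j + 1)`; the point `x
    -- j` then meets `k j` and `k (j + 1)`.
    rw [Finset.prod_univ_sum, Fintype.piFinset_univ, Finset.mul_sum,
      ← ((finRotate n).arrowCongr (Equiv.refl (Fin m))).symm.sum_comp]
    refine Finset.sum_congr rfl fun k _ => ?_
    rw [Finset.prod_mul_distrib, Finset.prod_mul_distrib, Finset.prod_mul_distrib]
    congr 1
    rw [mul_comm]
    congr 1
    rw [← Equiv.prod_comp (finRotate n) fun j => φ (k j) (x j)]
    rfl
  have hi : ∀ k : Fin n → Fin m, Integrable (fun x : Fin n → E =>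
      ∏ j, h j (x j) * (φ (k j) (x j) * φ (k (finRotate n j)) (x j))) (Measure.pi fun _ => ν) :=
    fun k => Integrable.fintype_prod
      (f := fun j y => h j y * (φ (k j) y * φ (k (finRotate n j)) y)) fun i => hint i _ _
  rw [he]
  refine ⟨integrable_finsetSum _ fun k _ => hi k, ?_⟩
  rw [integral_finsetSum _ fun k _ => hi k]
  exact Finset.sum_congr rfl fun k _ => integral_fintype_prod_eq_prod
    fun j y => h j y * (φ (k j) y * φ (k (finRotate n j)) y)

/-- The top coefficient of the logarithm of the determinant in terms of cyclic integrals. -/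
theorem coeff_logDet_genMatrix
    (hint : ∀ (B : Finset ι) j k, Integrable (fun x => (∏ r ∈ B, f r x) * (φ j x * φ k x)) ν) :
    (logDet (Fintype.card ι) (genMatrix ν φ f)).coeff (ind Finset.univ) =
      ∑ P : Finpartition (Finset.univ : Finset ι), ∑ σ : Equiv.Perm (Fin P.parts.card),
        (-1 : ℝ) ^ (P.parts.card - 1) / P.parts.card *
          ∫ x : Fin P.parts.card → E, ∏ j, (∏ r ∈ numbering P σ j, f r (x j)) *
            projKernel φ (x j) (x (finRotate _ j)) ∂(Measure.pi fun _ => ν) := by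
  rw [sum_numberings fun n c => (-1 : ℝ) ^ (n - 1) / n *
    ∫ x : Fin n → E, ∏ j, (∏ r ∈ c j, f r (x j)) *
      projKernel φ (x j) (x (finRotate _ j)) ∂(Measure.pi fun _ => ν), logDet,
    MvPolynomial.coeff_sum]
  refine Finset.sum_congr rfl fun n _ => ?_
  rw [MvPolynomial.coeff_C_mul, ← Finset.mul_sum]
  -- For `n = 0` both sides vanish, again through `1 / 0 = 0`.
  rcases eq_or_ne n 0 with rfl | hn
  · simp
  congr 1
  rw [trace_pow_eq_sum_cycles _ n hn, MvPolynomial.coeff_sum]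
  refine Eq.trans ?_ (Finset.sum_congr rfl fun c _ => (integral_cyclic_projKernel
    (h := fun i x => ∏ r ∈ c i, f r x) fun i => hint (c i)).2).symm
  rw [Finset.sum_comm]
  refine Finset.sum_congr rfl fun k _ => ?_
  simp only [genMatrix]
  rw [coeff_ind_prod_gen, Finset.sum_filter]
  refine Finset.sum_congr rfl fun c _ => ?_
  -- Splittings with an empty part drop out because `genMatrix` has no term for `∅`.
  split_ifs with hc
  · exact Finset.prod_congr rfl fun j _ => if_neg (hc j)
  · push Not at hc
    obtain ⟨j, hj⟩ := hc
    exact Finset.prod_eq_zero (Finset.mem_univ j) (if_pos hj)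

/-- The determinantal point process with `m` particles and the given orthonormal functions. -/
def ensemble (ν : Measure E) (φ : Fin m → E → ℝ) : Measure (Fin m → E) :=
  (Measure.pi fun _ => ν).withDensity fun x => ENNReal.ofReal (slater φ x ^ 2 / m.factorial)

theorem measurable_slater (hφ : ∀ k, Measurable (φ k)) : Measurable (slater φ) := by
  have : slater φ = fun x => ∑ σ : Equiv.Perm (Fin m), ((Equiv.Perm.sign σ : ℤ) : ℝ) *
      ∏ i, φ (σ i) (x i) := by
    ext x
    simp [slater, Matrix.det_apply']
  rw [this]
  fun_prop

theorem integrable_ensemble_iff (hφ : ∀ k, Measurable (φ k)) {g : (Fin m → E) → ℝ} :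
    Integrable g (ensemble ν φ) ↔
      Integrable (fun x => g x * slater φ x ^ 2) (Measure.pi fun _ => ν) := by
  have hm : Measurable fun x => ENNReal.ofReal (slater φ x ^ 2 / m.factorial) :=
    (((measurable_slater hφ).pow_const 2).div_const _).ennreal_ofReal
  rw [ensemble, integrable_withDensity_iff_integrable_smul' hm (by simp)]
  have : (fun x => (ENNReal.ofReal (slater φ x ^ 2 / m.factorial)).toReal • g x) =
      fun x => (m.factorial : ℝ)⁻¹ * (g x * slater φ x ^ 2) := by
    ext x
    rw [ENNReal.toReal_ofReal (by positivity), smul_eq_mul]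
    ring
  rw [this]
  exact integrable_const_mul_iff (isUnit_iff_ne_zero.2 (by positivity)) _

theorem integral_ensemble (hφ : ∀ k, Measurable (φ k)) (g : (Fin m → E) → ℝ) :
    ∫ x, g x ∂(ensemble ν φ) =
      (m.factorial : ℝ)⁻¹ * ∫ x, g x * slater φ x ^ 2 ∂(Measure.pi fun _ => ν) := by
  have hm : Measurable fun x => ENNReal.ofReal (slater φ x ^ 2 / m.factorial) :=
    (((measurable_slater hφ).pow_const 2).div_const _).ennreal_ofReal
  rw [ensemble, integral_withDensity_eq_integral_toReal_smul hm (by simp), ← integral_const_mul]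
  refine integral_congr_ae (ae_of_all _ fun x => ?_)
  dsimp only
  rw [ENNReal.toReal_ofReal (by positivity), smul_eq_mul]
  ring

theorem integral_ensemble_prod (hφ : ∀ k, Measurable (φ k))
    (hint : ∀ (B : Finset ι) j k, Integrable (fun x => (∏ r ∈ B, f r x) * (φ j x * φ k x)) ν)
    (horth : ∀ j k, ∫ x, φ j x * φ k x ∂ν = if j = k then 1 else 0) (B : Finset ι) :
    Integrable (fun x => ∏ r ∈ B, ∑ i, f r (x i)) (ensemble ν φ) ∧
    ∫ x, ∏ r ∈ B, ∑ i, f r (x i) ∂(ensemble ν φ) =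
      (1 + genMatrix ν φ f).det.coeff (ind B) := by
  rw [integrable_ensemble_iff hφ, integral_ensemble hφ]
  obtain ⟨h1, h2⟩ := integral_prod_sum_mul_slater_sq hint horth B
  refine ⟨h1, ?_⟩
  rw [h2, ← mul_assoc, inv_mul_cancel₀ (by positivity), one_mul]

/-- The recursion between moments and cumulants of linear statistics of the ensemble. -/
theorem ensemble_recursion (hφ : ∀ k, Measurable (φ k))
    (hint : ∀ (B : Finset ι) j k, Integrable (fun x => (∏ r ∈ B, f r x) * (φ j x * φ k x)) ν)
    (horth : ∀ j k, ∫ x, φ j x * φ k x ∂ν = if j = k then 1 else 0) {B : Finset ι} {r : ι}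
    (hr : r ∉ B) :
    ∫ x, ∏ q ∈ insert r B, ∑ i, f q (x i) ∂(ensemble ν φ) = ∑ C ∈ B.powerset,
      (logDet (Fintype.card ι) (genMatrix ν φ f)).coeff (ind (insert r C)) *
        ∫ x, ∏ q ∈ B \ C, ∑ i, f q (x i) ∂(ensemble ν φ) := by
  simp only [(integral_ensemble_prod hφ hint horth _).2]
  refine coeff_det_one_add _ _ vanishesBelow_genMatrix hr ?_
  have := Finset.card_le_univ (insert r B)
  rw [Finset.card_insert_of_notMem hr] at this
  omega

/-- The total mass is the moment of the empty product. With no variables at all, the generating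
matrix is zero and this moment is `det 1 = 1`. -/
theorem isProbabilityMeasure_ensemble (hφ : ∀ k, Measurable (φ k))
    (hint : ∀ j k, Integrable (fun x => φ j x * φ k x) ν)
    (horth : ∀ j k, ∫ x, φ j x * φ k x ∂ν = if j = k then 1 else 0) :
    IsProbabilityMeasure (ensemble ν φ) := by
  have h := integral_ensemble_prod (ι := Empty) (f := fun r => r.elim) hφ
    (fun B j k => by simpa [Finset.eq_empty_of_isEmpty B] using hint j k) horth ∅
  have hz : genMatrix ν φ (fun r : Empty => (r.elim : E → ℝ)) = 0 := by
    ext1 j k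
    simp [genMatrix, gen, Finset.eq_empty_of_isEmpty]
  rw [hz] at h
  simp only [Finset.prod_empty, add_zero, Matrix.det_one, ind, Finset.sum_empty,
    integral_const, smul_eq_mul, mul_one, MvPolynomial.coeff_zero_one] at h
  refine ⟨?_⟩
  have h2 := h.2
  rw [measureReal_def, ENNReal.toReal_eq_one_iff] at h2
  exact h2

end DeterminantalEnsemble


/-! ### Orthogonality of Laguerre polynomials and the law of the ensemble. -/

section Laguerre

variable {α : ℝ}

/-- Lebesgue measure on the half-line `[0, ∞)`. -/
def halfLine : Measure ℝ := volume.restrict (Set.Ici 0)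

instance : SigmaFinite halfLine := by
  unfold halfLine
  infer_instance

theorem weight_nonneg {x : ℝ} (hx : 0 ≤ x) : 0 ≤ weight α x :=
  mul_nonneg (Real.rpow_nonneg hx _) (Real.exp_pos _).le

theorem Gamma_pos (hα : 0 ≤ α) (n : ℕ) : 0 < Real.Gamma (n + α + 1) :=
  Real.Gamma_pos_of_pos (by positivity)

theorem integral_pow_mul_weight (hα : 0 ≤ α) (n : ℕ) :
    Integrable (fun x => x ^ n * weight α x) halfLine ∧
      ∫ x, x ^ n * weight α x ∂halfLine = Real.Gamma (n + α + 1) := by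
  have hpos : (0 : ℝ) < n + α + 1 := by positivity
  have he : ∀ x ∈ Set.Ioi (0 : ℝ),
      Real.exp (-x) * x ^ ((n : ℝ) + α + 1 - 1) = x ^ n * weight α x := fun x hx => by
    rw [add_sub_cancel_right, Real.rpow_add hx, Real.rpow_natCast, weight]
    ring
  rw [halfLine, ← Measure.restrict_congr_set Ioi_ae_eq_Ici]
  refine ⟨?_, ?_⟩
  · exact (integrableOn_congr_fun he measurableSet_Ioi).1 (Real.GammaIntegral_convergent hpos)
  · rw [Real.Gamma_eq_integral hpos]
    exact (setIntegral_congr_fun measurableSet_Ioi he).symm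

/-- The coefficient of `x ^ j` in the Laguerre polynomial of degree `k`. -/
def laguerreCoeff (α : ℝ) (k j : ℕ) : ℝ :=
  (-1) ^ j * (Real.Gamma (k + α + 1) / ((k - j).factorial * Real.Gamma (α + j + 1))) / j.factorial

theorem laguerre_eq (k : ℕ) (x : ℝ) :
    laguerre α k x = ∑ j ∈ Finset.range (k + 1), laguerreCoeff α k j * x ^ j := by
  rw [laguerre]
  exact Finset.sum_congr rfl fun j _ => by rw [laguerreCoeff]; ring

theorem laguerreCoeff_self (hα : 0 ≤ α) (k : ℕ) :
    laguerreCoeff α k k = (-1) ^ k / k.factorial := by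
  have := (Gamma_pos hα k).ne'
  rw [laguerreCoeff, Nat.sub_self, Nat.factorial_zero, Nat.cast_one, one_mul, add_comm α,
    div_self this, mul_one]

theorem Gamma_add_nat (z : ℝ) (hz : 0 < z) (i : ℕ) :
    Real.Gamma (z + i) = (ascPochhammer ℝ i).eval z * Real.Gamma z := by
  induction i with
  | zero => simp
  | succ i ih =>
    rw [Nat.cast_succ, ← add_assoc, Real.Gamma_add_one (by positivity), ih,
      ascPochhammer_succ_eval]
    ring

/-- Up to sign this is the `k`-th forward difference at `0`, which annihilates degrees below `k`. -/
theorem alternating_sum_eval (p : Polynomial ℝ) (k : ℕ) (hp : p.natDegree ≤ k) :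
    ∑ j ∈ Finset.range (k + 1), (-1 : ℝ) ^ j * k.choose j * p.eval (j : ℝ) =
      (-1) ^ k * (p.coeff k * k.factorial) := by
  have h1 : ∑ j ∈ Finset.range (k + 1), (-1 : ℝ) ^ j * k.choose j * p.eval (j : ℝ) =
      (-1) ^ k * (fwdDiff 1)^[k] p.eval 0 := by
    rw [fwdDiff_iter_eq_sum_shift, Finset.mul_sum]
    refine Finset.sum_congr rfl fun j hj => ?_
    have hjk : j ≤ k := Nat.lt_succ_iff.1 (Finset.mem_range.1 hj)
    have h2 : (-1 : ℝ) ^ k * (-1) ^ (k - j) = (-1) ^ j := by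
      have h3 : k + (k - j) = j + 2 * (k - j) := by omega
      rw [← pow_add, h3, pow_add, pow_mul]
      simp
    rw [zsmul_eq_mul]
    push_cast
    rw [← h2]
    simp
    ring
  rw [h1]
  congr 1
  rcases hp.lt_or_eq with h | h
  · rw [Polynomial.fwdDiff_iter_eq_zero_of_degree_lt h, Polynomial.coeff_eq_zero_of_natDegree_lt h]
    simp
  · subst h
    rw [Polynomial.fwdDiff_iter_degree_eq_factorial]
    simp

/-- Integrating termwise leaves the quotients `Γ(i + j + α + 1) / Γ(j + α + 1)`. As a function of
`j` such a quotient is a monic polynomial of degree `i`, and the rest is an alternating binomial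
sum. -/
theorem integral_pow_mul_laguerre (hα : 0 ≤ α) (i k : ℕ) (hik : i ≤ k) :
    Integrable (fun x => x ^ i * laguerre α k x * weight α x) halfLine ∧
    ∫ x, x ^ i * laguerre α k x * weight α x ∂halfLine =
      if i = k then (-1) ^ k * Real.Gamma (k + α + 1) else 0 := by
  have he : (fun x => x ^ i * laguerre α k x * weight α x) = fun x =>
      ∑ j ∈ Finset.range (k + 1), laguerreCoeff α k j * (x ^ (i + j) * weight α x) := by
    ext x
    rw [laguerre_eq, Finset.mul_sum, Finset.sum_mul]
    exact Finset.sum_congr rfl fun j _ => by ring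
  have hi := fun j => ((integral_pow_mul_weight hα (i + j)).1.const_mul (laguerreCoeff α k j))
  rw [he]
  refine ⟨integrable_finsetSum _ fun j _ => hi j, ?_⟩
  rw [integral_finsetSum _ fun j _ => hi j]
  simp only [integral_const_mul, (integral_pow_mul_weight hα _).2]
  set p : Polynomial ℝ := (ascPochhammer ℝ i).comp (Polynomial.X + Polynomial.C (α + 1)) with hp
  have hmonic : p.Monic := (monic_ascPochhammer ℝ i).comp_X_add_C _
  have hdeg : p.natDegree = i := by
    rw [hp, Polynomial.natDegree_comp, ascPochhammer_natDegree, Polynomial.natDegree_X_add_C,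
      mul_one]
  have hterm : ∀ j ∈ Finset.range (k + 1),
      laguerreCoeff α k j * Real.Gamma ((i + j : ℕ) + α + 1) =
      Real.Gamma (k + α + 1) / k.factorial * ((-1 : ℝ) ^ j * k.choose j * p.eval (j : ℝ)) := by
    intro j hj
    have hjk : j ≤ k := Nat.lt_succ_iff.1 (Finset.mem_range.1 hj)
    have h1 : ((i + j : ℕ) : ℝ) + α + 1 = (α + j + 1) + i := by push_cast; ring
    have h2 : p.eval (j : ℝ) = (ascPochhammer ℝ i).eval (α + j + 1) := by
      rw [hp, Polynomial.eval_comp]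
      simp only [Polynomial.eval_add, Polynomial.eval_X, Polynomial.eval_C]
      congr 1
      ring
    have h3 : Real.Gamma (α + j + 1) ≠ 0 := (Real.Gamma_pos_of_pos (by positivity)).ne'
    rw [h1, Gamma_add_nat _ (by positivity), h2, laguerreCoeff, Nat.cast_choose ℝ hjk]
    field_simp
  rw [Finset.sum_congr rfl hterm, ← Finset.mul_sum, alternating_sum_eval p k (hdeg ▸ hik)]
  split_ifs with h
  · subst h
    have : p.coeff i = 1 := by
      have := hmonic.coeff_natDegree
      rwa [hdeg] at this
    rw [this]
    field_simp
  · rw [Polynomial.coeff_eq_zero_of_natDegree_lt (by omega)]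
    simp

/-- Expand the polynomial of lower degree: the other one is orthogonal to all smaller powers, so at
most the leading term contributes. -/
theorem integral_laguerre_mul_laguerre (hα : 0 ≤ α) (j k : ℕ) :
    Integrable (fun x => laguerre α j x * laguerre α k x * weight α x) halfLine ∧
    ∫ x, laguerre α j x * laguerre α k x * weight α x ∂halfLine =
      if j = k then Real.Gamma (k + α + 1) / k.factorial else 0 := by
  wlog hjk : j ≤ k generalizing j k
  · have := this k j (le_of_not_ge hjk)
    simp only [mul_comm (laguerre α j _)]
    refine ⟨this.1, this.2.trans ?_⟩
    rw [if_neg (by omega), if_neg (by omega)]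
  have he : (fun x => laguerre α j x * laguerre α k x * weight α x) = fun x =>
      ∑ i ∈ Finset.range (j + 1), laguerreCoeff α j i * (x ^ i * laguerre α k x * weight α x) := by
    ext x
    rw [laguerre_eq, Finset.sum_mul, Finset.sum_mul]
    exact Finset.sum_congr rfl fun i _ => by ring
  have hle : ∀ i ∈ Finset.range (j + 1), i ≤ k := fun i hi => by
    have := Finset.mem_range.1 hi
    omega
  have hi := fun i hi => ((integral_pow_mul_laguerre hα i k (hle i hi)).1.const_mul
    (laguerreCoeff α j i))
  rw [he]
  refine ⟨integrable_finsetSum _ hi, ?_⟩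
  rw [integral_finsetSum _ hi, Finset.sum_range_succ, Finset.sum_eq_zero fun i h => ?_, zero_add,
    integral_const_mul, (integral_pow_mul_laguerre hα j k hjk).2]
  · split_ifs with h
    · subst h
      rw [laguerreCoeff_self hα]
      have : ((-1 : ℝ) ^ j) * (-1) ^ j = 1 := by rw [← mul_pow]; simp
      rw [div_mul_eq_mul_div, ← mul_assoc, this, one_mul]
    · simp
  · have h' := Finset.mem_range.1 h
    rw [integral_const_mul, (integral_pow_mul_laguerre hα i k (by omega)).2, if_neg (by omega),
      mul_zero]

/-- The orthonormal functions `√(w k! / Γ(k + α + 1)) L_k`. -/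
def laguerreFun (α : ℝ) (k : ℕ) (x : ℝ) : ℝ :=
  Real.sqrt (weight α x * (k.factorial / Real.Gamma (k + α + 1))) * laguerre α k x

theorem measurable_laguerreFun (k : ℕ) : Measurable (laguerreFun α k) := by
  unfold laguerreFun laguerre weight
  fun_prop

theorem laguerreFun_mul_laguerreFun (j k : ℕ) {x : ℝ} (hx : 0 ≤ x) :
    laguerreFun α j x * laguerreFun α k x =
      Real.sqrt (j.factorial / Real.Gamma (j + α + 1)) *
        Real.sqrt (k.factorial / Real.Gamma (k + α + 1)) *
        (laguerre α j x * laguerre α k x * weight α x) := by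
  rw [laguerreFun, laguerreFun, Real.sqrt_mul (weight_nonneg hx), Real.sqrt_mul (weight_nonneg hx)]
  nth_rw 3 [← Real.mul_self_sqrt (weight_nonneg (α := α) hx)]
  ring

theorem ae_halfLine_nonneg : ∀ᵐ x ∂halfLine, 0 ≤ x :=
  ae_restrict_mem measurableSet_Ici

theorem integral_laguerreFun_mul_laguerreFun (hα : 0 ≤ α) (j k : ℕ) :
    Integrable (fun x => laguerreFun α j x * laguerreFun α k x) halfLine ∧
    ∫ x, laguerreFun α j x * laguerreFun α k x ∂halfLine = if j = k then 1 else 0 := by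
  have he : (fun x => laguerreFun α j x * laguerreFun α k x) =ᵐ[halfLine] fun x =>
      Real.sqrt (j.factorial / Real.Gamma (j + α + 1)) *
        Real.sqrt (k.factorial / Real.Gamma (k + α + 1)) *
        (laguerre α j x * laguerre α k x * weight α x) :=
    ae_halfLine_nonneg.mono fun x hx => laguerreFun_mul_laguerreFun j k hx
  refine ⟨((integral_laguerre_mul_laguerre hα j k).1.const_mul _).congr he.symm, ?_⟩
  rw [integral_congr_ae he, integral_const_mul, (integral_laguerre_mul_laguerre hα j k).2]
  split_ifs with h
  · subst h
    have := Gamma_pos hα j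
    rw [Real.mul_self_sqrt (by positivity)]
    field_simp
  · simp

/-- The orthonormal functions of the ensemble with `m` particles. -/
def laguerreSystem (m : ℕ) (α : ℝ) (k : Fin m) : ℝ → ℝ := laguerreFun α k

theorem kernel_eq_projKernel (hα : 0 ≤ α) (m : ℕ) {x y : ℝ} (hx : 0 ≤ x) (hy : 0 ≤ y) :
    kernel m α x y = projKernel (laguerreSystem m α) x y := by
  rw [kernel, projKernel, Finset.mul_sum, ← Fin.sum_univ_eq_sum_range fun k =>
    Real.sqrt (weight α x * weight α y) *
      (k.factorial / Real.Gamma (k + α + 1) * (laguerre α k x * laguerre α k y))]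
  refine Finset.sum_congr rfl fun k _ => ?_
  have hG := Gamma_pos hα k
  have hc : (0 : ℝ) ≤ (k : ℕ).factorial / Real.Gamma (k + α + 1) := by positivity
  rw [laguerreSystem, laguerreFun, laguerreFun, Real.sqrt_mul (weight_nonneg hx),
    Real.sqrt_mul (weight_nonneg hx), Real.sqrt_mul (weight_nonneg hy)]
  nth_rw 1 [← Real.mul_self_sqrt hc]
  ring

/-- The Laguerre polynomial, normalized to leading coefficient one. -/
def monicLaguerre (α : ℝ) (k : ℕ) : Polynomial ℝ := Polynomial.X ^ k +
  ∑ j ∈ Finset.range k,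
    Polynomial.C ((-1) ^ k * k.factorial * laguerreCoeff α k j) * Polynomial.X ^ j

theorem degree_monicLaguerre_tail (k : ℕ) : (∑ j ∈ Finset.range k,
    Polynomial.C ((-1) ^ k * k.factorial * laguerreCoeff α k j) * Polynomial.X ^ j).degree < (k : WithBot ℕ) := by
  rw [← Polynomial.mem_degreeLT]
  refine Submodule.sum_mem _ fun j hj => ?_
  rw [Polynomial.mem_degreeLT]
  refine (Polynomial.degree_C_mul_X_pow_le _ _).trans_lt ?_
  exact_mod_cast Finset.mem_range.1 hj

theorem monic_monicLaguerre (k : ℕ) : (monicLaguerre α k).Monic :=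
  Polynomial.monic_X_pow_add (degree_monicLaguerre_tail k)

theorem natDegree_monicLaguerre (k : ℕ) : (monicLaguerre α k).natDegree = k := by
  rw [monicLaguerre, Polynomial.natDegree_add_eq_left_of_degree_lt, Polynomial.natDegree_X_pow]
  rw [Polynomial.degree_X_pow]
  exact degree_monicLaguerre_tail k

theorem eval_monicLaguerre (hα : 0 ≤ α) (k : ℕ) (x : ℝ) :
    laguerre α k x = (-1) ^ k / k.factorial * (monicLaguerre α k).eval x := by
  have h1 : ((-1 : ℝ) ^ k) * (-1) ^ k = 1 := by rw [← mul_pow]; simp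
  have h2 : (k.factorial : ℝ) ≠ 0 := by positivity
  rw [laguerre_eq, Finset.sum_range_succ, laguerreCoeff_self hα, monicLaguerre,
    Polynomial.eval_add, Polynomial.eval_finsetSum, mul_add, Finset.mul_sum, add_comm]
  congr 1
  · simp
  · refine Finset.sum_congr rfl fun j _ => ?_
    simp only [Polynomial.eval_mul, Polynomial.eval_C, Polynomial.eval_pow, Polynomial.eval_X]
    field_simp
    rw [sq, h1, mul_one]

/-- The squared normalization constant that relates the density to a squared determinant. -/
def densityConst (m : ℕ) (α : ℝ) : ℝ :=
  ∏ k : Fin m, ((k : ℕ).factorial * Real.Gamma (k + α + 1))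

theorem densityConst_pos (hα : 0 ≤ α) (m : ℕ) : 0 < densityConst m α :=
  Finset.prod_pos fun k _ => mul_pos (by positivity) (Gamma_pos hα k)

/-- Polynomials of degrees `0, …, m - 1` have the Vandermonde determinant times their leading
coefficients. These and the normalizations are collected in `densityConst`. -/
theorem density_eq_slater_sq (hα : 0 ≤ α) (m : ℕ) {x : Fin m → ℝ} (hx : ∀ i, 0 ≤ x i) :
    density m α x = densityConst m α * slater (laguerreSystem m α) x ^ 2 := by
  have h1 : slater (laguerreSystem m α) x = (∏ i, Real.sqrt (weight α (x i))) *
      ((∏ k : Fin m, Real.sqrt ((k : ℕ).factorial / Real.Gamma (k + α + 1)) *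
        ((-1) ^ (k : ℕ) / (k : ℕ).factorial)) * (Matrix.vandermonde x).det) := by
    rw [Matrix.det_eval_matrixOfPolynomials_eq_det_vandermonde x
      (fun k => monicLaguerre α k) (fun k => natDegree_monicLaguerre k)
      (fun k => monic_monicLaguerre k), ← Matrix.det_mul_row, ← Matrix.det_mul_column, slater,
      ← Matrix.det_transpose]
    congr 1
    ext i k
    simp only [Matrix.transpose_apply, Matrix.of_apply, laguerreSystem, laguerreFun]
    rw [eval_monicLaguerre hα, Real.sqrt_mul (weight_nonneg (hx i))]
    ring
  have h2 : ∀ k : Fin m, ((k : ℕ).factorial * Real.Gamma (k + α + 1)) *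
      (Real.sqrt ((k : ℕ).factorial / Real.Gamma (k + α + 1)) *
        ((-1) ^ (k : ℕ) / (k : ℕ).factorial)) ^ 2 = 1 := fun k => by
    have := Gamma_pos hα k
    rw [mul_pow, Real.sq_sqrt (by positivity), div_pow, ← pow_mul, mul_comm (k : ℕ) 2, pow_mul]
    field_simp
    norm_num
  rw [h1, mul_pow, mul_pow, ← Finset.prod_pow, ← Finset.prod_pow, densityConst]
  have h3 := Finset.prod_congr (s₁ := (Finset.univ : Finset (Fin m))) rfl fun k _ => h2 k
  rw [Finset.prod_mul_distrib, Finset.prod_const_one] at h3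
  have h4 : ∏ i, Real.sqrt (weight α (x i)) ^ 2 = ∏ i, weight α (x i) :=
    Finset.prod_congr rfl fun i _ => Real.sq_sqrt (weight_nonneg (hx i))
  have h5 : ∏ i : Fin m, ∏ j ∈ Finset.Ioi i, (x i - x j) ^ 2 = (Matrix.vandermonde x).det ^ 2 := by
    rw [Matrix.det_vandermonde, ← Finset.prod_pow]
    refine Finset.prod_congr rfl fun i _ => ?_
    rw [← Finset.prod_pow]
    exact Finset.prod_congr rfl fun j _ => by ring
  rw [h4, density, h5]
  linear_combination (-(Matrix.vandermonde x).det ^ 2 * ∏ i, weight α (x i)) * h3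

theorem volume_restrict_orthant (n : ℕ) :
    (volume : Measure (Fin n → ℝ)).restrict (Set.univ.pi fun _ => Set.Ici 0) =
      Measure.pi fun _ => halfLine := by
  rw [volume_pi, Measure.restrict_pi_pi]
  rfl

theorem ae_orthant_nonneg (n : ℕ) :
    ∀ᵐ x ∂(Measure.pi fun _ : Fin n => halfLine), ∀ i, 0 ≤ x i := by
  rw [← volume_restrict_orthant]
  have hm : MeasurableSet (Set.univ.pi fun _ : Fin n => Set.Ici (0 : ℝ)) :=
    MeasurableSet.univ_pi fun _ => measurableSet_Ici
  filter_upwards [ae_restrict_mem hm] with x hx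
  exact fun i => hx i (Set.mem_univ i)

theorem isProbabilityMeasure_laguerre (m : ℕ) (hα : 0 ≤ α) :
    IsProbabilityMeasure (ensemble halfLine (laguerreSystem m α)) :=
  isProbabilityMeasure_ensemble (fun k => measurable_laguerreFun k)
    (fun j k => (integral_laguerreFun_mul_laguerreFun hα j k).1) fun j k => by
      simpa only [Fin.ext_iff, laguerreSystem] using (integral_laguerreFun_mul_laguerreFun hα j k).2

/-- The Wishart-Laguerre ensemble is determinantal. -/
theorem law_eq_ensemble (m : ℕ) (hα : 0 ≤ α) :
    law m α = ensemble halfLine (laguerreSystem m α) := by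
  have hc : 0 < densityConst m α * m.factorial := mul_pos (densityConst_pos hα m) (by positivity)
  -- Proportionality to a probability measure suffices: normalizing cancels the constant.
  have h1 : unnormalized m α =
      ENNReal.ofReal (densityConst m α * m.factorial) •
        ensemble halfLine (laguerreSystem m α) := by
    rw [unnormalized, volume_restrict_orthant, ensemble,
      ← withDensity_smul' _ _ ENNReal.ofReal_ne_top]
    refine withDensity_congr_ae ?_
    filter_upwards [ae_orthant_nonneg m] with x hx
    rw [Pi.smul_apply, smul_eq_mul, ← ENNReal.ofReal_mul hc.le, density_eq_slater_sq hα m hx]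
    congr 1
    field_simp
  have := isProbabilityMeasure_laguerre m hα
  rw [law, h1, Measure.smul_apply, measure_univ, smul_eq_mul, mul_one, smul_smul,
    ENNReal.inv_mul_cancel (by simpa using hc) ENNReal.ofReal_ne_top, one_smul]

end Laguerre


/-! ### From moments of linear statistics to one-particle integrability. -/

section DensityOfStates

variable {E : Type*} [MeasurableSpace E] {ν : Measure E} [SigmaFinite ν] {m : ℕ}
  {φ : Fin m → E → ℝ}

theorem Integrable.bounded_mul_mul (hint : ∀ j k, Integrable (fun x => φ j x * φ k x) ν)
    {g : E → ℝ} (hg : Measurable g) {c : ℝ} (hc : ∀ x, |g x| ≤ c) (j k : Fin m) :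
    Integrable (fun x => g x * (φ j x * φ k x)) ν :=
  (hint j k).bdd_mul hg.aestronglyMeasurable (ae_of_all _ hc)

/-- The mean of a linear statistic of a bounded function. -/
theorem integral_ensemble_sum (hφ : ∀ k, Measurable (φ k))
    (hint : ∀ j k, Integrable (fun x => φ j x * φ k x) ν)
    (horth : ∀ j k, ∫ x, φ j x * φ k x ∂ν = if j = k then 1 else 0)
    {g : E → ℝ} (hg : Measurable g) {c : ℝ} (hc : ∀ x, |g x| ≤ c) :
    Integrable (fun x => ∑ i, g (x i)) (ensemble ν φ) ∧
    ∫ x, ∑ i, g (x i) ∂(ensemble ν φ) = ∑ k, ∫ x, g x * (φ k x * φ k x) ∂ν := by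
  -- With a single variable, the recursion at `B = ∅` reads off the mean as the linear coefficient
  -- of the logarithm, that is a trace.
  have hB : ∀ B : Finset Unit, B = ∅ ∨ B = {()} := by decide
  have hint' : ∀ (B : Finset Unit) j k,
      Integrable (fun x => (∏ r ∈ B, (fun _ : Unit => g) r x) * (φ j x * φ k x)) ν := by
    intro B j k
    rcases hB B with rfl | rfl
    · simpa using hint j k
    · simpa using Integrable.bounded_mul_mul hint hg hc j k
  have hprob := isProbabilityMeasure_ensemble hφ hint horth
  have h1 := integral_ensemble_prod hφ hint' horth {()}
  have h2 := ensemble_recursion (f := fun _ : Unit => g) hφ hint' horth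
    (Finset.notMem_empty ())
  simp only [Finset.prod_singleton] at h1
  refine ⟨h1.1, ?_⟩
  simp only [insert_empty_eq, Finset.prod_singleton, Finset.powerset_empty, Finset.sum_singleton,
    Finset.sdiff_self, Finset.prod_empty, integral_const, measureReal_def, measure_univ,
    ENNReal.toReal_one, smul_eq_mul, mul_one, Fintype.card_unit] at h2
  rw [h2, logDet, Finset.sum_range_succ, Finset.sum_range_one, MvPolynomial.coeff_add]
  simp only [MvPolynomial.coeff_C_mul, Nat.cast_zero, div_zero, zero_mul, zero_add, pow_one,
    Nat.cast_one, Nat.sub_self, pow_zero, div_one, one_mul, Matrix.trace, Matrix.diag_apply,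
    MvPolynomial.coeff_sum, genMatrix, coeff_gen]
  refine Finset.sum_congr rfl fun k _ => ?_
  rw [if_neg (Finset.singleton_ne_empty ())]
  simp [multMatrix]

/-- If the mean of a linear statistic of a non-negative function is finite, then the function is
integrable with respect to the density of states. -/
theorem integrable_of_integrable_ensemble_sum (hφ : ∀ k, Measurable (φ k))
    (hint : ∀ j k, Integrable (fun x => φ j x * φ k x) ν)
    (horth : ∀ j k, ∫ x, φ j x * φ k x ∂ν = if j = k then 1 else 0)
    {h : E → ℝ} (hh : Measurable h) (h0 : ∀ x, 0 ≤ h x)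
    (hsum : Integrable (fun x => ∑ i, h (x i)) (ensemble ν φ)) (k : Fin m) :
    Integrable (fun x => h x * (φ k x * φ k x)) ν := by
  -- The mean formula is available for bounded functions only, so `h` is truncated at `N`; monotone
  -- convergence removes the truncation.
  have hm : ∀ N : ℕ, Measurable fun x => min (h x) N := fun N => hh.min measurable_const
  have hb : ∀ (N : ℕ) x, |min (h x) N| ≤ N := fun N x => by
    rw [abs_of_nonneg (le_min (h0 x) N.cast_nonneg)]
    exact min_le_right _ _
  have hnn : ∀ (N : ℕ) k x, 0 ≤ min (h x) N * (φ k x * φ k x) := fun N k x =>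
    mul_nonneg (le_min (h0 x) N.cast_nonneg) (mul_self_nonneg _)
  set M := ∫ x, ∑ i, h (x i) ∂(ensemble ν φ) with hM
  have hle : ∀ N : ℕ, ∫ x, min (h x) N * (φ k x * φ k x) ∂ν ≤ M := fun N => by
    obtain ⟨h1, h2⟩ := integral_ensemble_sum hφ hint horth (hm N) (hb N)
    calc _ ≤ ∑ k, ∫ x, min (h x) N * (φ k x * φ k x) ∂ν :=
          Finset.single_le_sum (f := fun k => ∫ x, min (h x) N * (φ k x * φ k x) ∂ν)
            (fun k _ => integral_nonneg (hnn N k)) (Finset.mem_univ k)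
      _ = ∫ x, ∑ i, min (h (x i)) N ∂(ensemble ν φ) := h2.symm
      _ ≤ M := integral_mono h1 hsum fun x => Finset.sum_le_sum fun i _ => min_le_left _ _
  have hmeas : Measurable fun x => h x * (φ k x * φ k x) := hh.mul ((hφ k).mul (hφ k))
  have hlim := lintegral_tendsto_of_tendsto_of_monotone (μ := ν)
    (f := fun (N : ℕ) x => ENNReal.ofReal (min (h x) N * (φ k x * φ k x)))
    (F := fun x => ENNReal.ofReal (h x * (φ k x * φ k x)))
    (fun N => ((hm N).mul ((hφ k).mul (hφ k))).ennreal_ofReal.aemeasurable)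
    (ae_of_all _ fun x N N' hN => ENNReal.ofReal_le_ofReal
      (mul_le_mul_of_nonneg_right (min_le_min_left _ (Nat.cast_le.2 hN)) (mul_self_nonneg _)))
    (ae_of_all _ fun x => tendsto_const_nhds.congr' (by
      obtain ⟨N, hN⟩ := exists_nat_ge (h x)
      filter_upwards [Filter.eventually_ge_atTop N] with N' hN'
      rw [min_eq_left (hN.trans (Nat.cast_le.2 hN'))]))
  have hfin : ∫⁻ x, ENNReal.ofReal (h x * (φ k x * φ k x)) ∂ν ≤ ENNReal.ofReal M := by
    refine le_of_tendsto' hlim fun N => ?_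
    rw [← ofReal_integral_eq_lintegral_ofReal
      (Integrable.bounded_mul_mul hint (hm N) (hb N) k k) (ae_of_all _ (hnn N k))]
    exact ENNReal.ofReal_le_ofReal (hle N)
  refine ⟨hmeas.aestronglyMeasurable, ?_⟩
  rw [hasFiniteIntegral_iff_ofReal (ae_of_all _ fun x => mul_nonneg (h0 x) (mul_self_nonneg _))]
  exact hfin.trans_lt ENNReal.ofReal_lt_top

/-- The product is at most a power `|B| ≤ l` of the largest factor, and such a power is below `1` or
below the `l`-th power. -/
theorem prod_abs_le_one_add_sum_pow {l : ℕ} (hl : 1 ≤ l) (y : Fin l → ℝ) (B : Finset (Fin l)) :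
    |∏ r ∈ B, y r| ≤ 1 + ∑ r, |y r| ^ l := by
  obtain ⟨r, -, hr⟩ := Finset.exists_max_image Finset.univ (fun r => |y r|)
    ⟨⟨0, hl⟩, Finset.mem_univ _⟩
  have h1 : |∏ r ∈ B, y r| ≤ |y r| ^ B.card := by
    rw [Finset.abs_prod]
    exact (Finset.prod_le_prod (fun _ _ => abs_nonneg _) fun q _ => hr q (Finset.mem_univ q)).trans
      (by rw [Finset.prod_const])
  have h2 : |y r| ^ l ≤ ∑ r, |y r| ^ l :=
    Finset.single_le_sum (f := fun r => |y r| ^ l) (fun _ _ => by positivity) (Finset.mem_univ r)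
  have h3 : 0 ≤ |y r| ^ l := by positivity
  rcases le_total (|y r|) 1 with h | h
  · have := pow_le_one₀ (abs_nonneg (y r)) h (n := B.card)
    linarith
  · have := pow_le_pow_right₀ h (show B.card ≤ l by simpa using Finset.card_le_univ B)
    linarith

/-- Moments of order `l` suffice for all `B`: off-diagonal products satisfy `|φ_j φ_k| ≤ φ_j² +
φ_k²`, and the diagonal is the density of states. -/
theorem integrable_prod_mul_mul {l : ℕ} (hl : 1 ≤ l) (hφ : ∀ k, Measurable (φ k))
    (hint : ∀ j k, Integrable (fun x => φ j x * φ k x) ν)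
    (horth : ∀ j k, ∫ x, φ j x * φ k x ∂ν = if j = k then 1 else 0)
    {f : Fin l → E → ℝ} (hf : ∀ r, Measurable (f r))
    (hmom : ∀ r, Integrable (fun x => ∑ i, |f r (x i)| ^ l) (ensemble ν φ))
    (B : Finset (Fin l)) (j k : Fin m) :
    Integrable (fun x => (∏ r ∈ B, f r x) * (φ j x * φ k x)) ν := by
  have h1 : ∀ k, Integrable (fun x => (1 + ∑ r, |f r x| ^ l) * (φ k x * φ k x)) ν := fun k => by
    simp only [add_mul, one_mul, Finset.sum_mul]
    exact (hint k k).add (integrable_finsetSum _ fun r _ =>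
      integrable_of_integrable_ensemble_sum hφ hint horth
        ((continuous_abs.measurable.comp (hf r)).pow_const l)
        (fun x => pow_nonneg (abs_nonneg _) _)
        (hmom r) k)
  have hm : Measurable fun x => (∏ r ∈ B, f r x) * (φ j x * φ k x) :=
    (Finset.measurable_fun_prod _ fun r _ => hf r).mul ((hφ j).mul (hφ k))
  refine ((h1 j).add (h1 k)).mono' hm.aestronglyMeasurable (ae_of_all _ fun x => ?_)
  rw [Real.norm_eq_abs, abs_mul, Pi.add_apply, ← mul_add]
  refine mul_le_mul (prod_abs_le_one_add_sum_pow hl (fun r => f r x) B) ?_ (abs_nonneg _)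
    (by positivity)
  rw [abs_le]
  constructor <;> nlinarith [sq_nonneg (φ j x - φ k x), sq_nonneg (φ j x + φ k x)]

end DensityOfStates

/-! ### Transfer to linear statistics and to the cyclic integrand. -/

theorem allMoments_linStat {m : ℕ} (hm : 1 ≤ m) {μ : Measure (Fin m → ℝ)} {g : ℝ → ℝ}
    (hg : Measurable g) (h : ∀ p : ℕ, Integrable (linStat m fun y => |g y| ^ p) μ) :
    AllMoments μ (linStat m g) := by
  have hmeas : Measurable (linStat m g) :=
    Finset.measurable_fun_sum _ fun i _ => hg.comp (measurable_pi_apply i)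
  refine ⟨hmeas.aestronglyMeasurable, fun p => ?_⟩
  refine ((h p).const_mul ((m : ℝ) ^ p)).mono'
    ((continuous_abs.measurable.comp hmeas).pow_const p).aestronglyMeasurable
    (ae_of_all _ fun x => ?_)
  obtain ⟨i, -, hi⟩ := Finset.exists_max_image Finset.univ (fun i => |g (x i)|)
    ⟨⟨0, hm⟩, Finset.mem_univ _⟩
  have h1 : |linStat m g x| ≤ m * |g (x i)| := by
    refine (Finset.abs_sum_le_sum_abs _ _).trans ((Finset.sum_le_sum hi).trans ?_)
    simp
  rw [Real.norm_eq_abs, abs_pow, abs_abs]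
  calc |linStat m g x| ^ p ≤ (m * |g (x i)|) ^ p := pow_le_pow_left₀ (abs_nonneg _) h1 p
    _ = (m : ℝ) ^ p * |g (x i)| ^ p := mul_pow _ _ _
    _ ≤ (m : ℝ) ^ p * linStat m (fun y => |g y| ^ p) x :=
      mul_le_mul_of_nonneg_left (Finset.single_le_sum (f := fun i => |g (x i)| ^ p)
        (fun _ _ => by positivity) (Finset.mem_univ i)) (by positivity)

/-- Attaching `x_{σ(j)}` to block `j` is attaching block `σ⁻¹(j)` to `x_j`. The kernels agree only
for non-negative arguments, where the square roots split, hence almost everywhere. -/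
theorem cyclicIntegrand_ae_eq {m l : ℕ} {α : ℝ} (hα : 0 ≤ α) (f : Fin l → ℝ → ℝ)
    (P : Finpartition (Finset.univ : Finset (Fin l))) (σ : Equiv.Perm (Fin P.parts.card)) :
    cyclicIntegrand m α f P σ =ᵐ[Measure.pi fun _ => halfLine] fun x =>
      ∏ j, (∏ r ∈ numbering P σ j, f r (x j)) *
        projKernel (laguerreSystem m α) (x j) (x (finRotate _ j)) := by
  filter_upwards [ae_orthant_nonneg P.parts.card] with x hx
  rw [cyclicIntegrand, Finset.prod_mul_distrib, Finset.prod_mul_distrib]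
  congr 1
  · rw [← Equiv.prod_comp σ fun j => ∏ r ∈ numbering P σ j, f r (x j)]
    simp [numbering]
  · exact Finset.prod_congr rfl fun j _ => kernel_eq_projKernel hα m (hx _) (hx _)

end LaguerreEnsemble

end

/-- Joint cumulants of linear statistics of the Wishart-Laguerre ensemble in terms of the
correlation kernel. The third part is about the joint cumulant as the mixed derivative
`∂^l K / ∂t_1 ⋯ ∂t_l` at `t = 0` of its generating function, whenever the latter is finite on a
box `∏_r [a_r, b_r]` containing `0`. If `a_r < 0 < b_r` for all `r`, this is the ordinary
derivative, and the condition on all moments there holds automatically; if `a_r = 0` or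
`b_r = 0`, it is one-sided in `t_r`, as it has to be for `f(x) = x ln x`, where
`E[exp(t X)] = ∞` for all `t > 0`. The fourth part is about the joint cumulant in terms of
moments, which needs no generating function. -/
theorem lemma3 (m l : ℕ) (hm : 1 ≤ m) (hl : 1 ≤ l) (α : ℝ) (hα : 0 ≤ α)
    (f : Fin l → ℝ → ℝ) (hf : ∀ r, Measurable (f r))
    (hmom : ∀ r, Integrable (LaguerreEnsemble.linStat m fun y => |f r y| ^ l)
      (LaguerreEnsemble.law m α)) :
    (∀ B : Finset (Fin l),
      Integrable (fun x => ∏ r ∈ B, LaguerreEnsemble.linStat m (f r) x)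
        (LaguerreEnsemble.law m α)) ∧
    (∀ (P : Finpartition (Finset.univ : Finset (Fin l))) (σ : Equiv.Perm (Fin P.parts.card)),
      IntegrableOn (LaguerreEnsemble.cyclicIntegrand m α f P σ)
        (Set.univ.pi fun _ => Set.Ici 0)) ∧
    (∀ a b : Fin l → ℝ, (∀ r, a r ≤ 0 ∧ 0 ≤ b r ∧ a r < b r) →
      (∀ r, ∀ p : ℕ, Integrable (LaguerreEnsemble.linStat m fun y => |f r y| ^ p)
        (LaguerreEnsemble.law m α)) →
      (∀ t ∈ Set.Icc a b,
        Integrable (fun x => Real.exp (∑ r, t r * LaguerreEnsemble.linStat m (f r) x))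
          (LaguerreEnsemble.law m α)) →
      ContDiffWithinAt ℝ l
        (jointCGF (LaguerreEnsemble.law m α) fun r => LaguerreEnsemble.linStat m (f r))
        (Set.Icc a b) 0 ∧
      iteratedFDerivWithin ℝ l
        (jointCGF (LaguerreEnsemble.law m α) fun r => LaguerreEnsemble.linStat m (f r))
        (Set.Icc a b) 0 (fun r => Pi.single r 1) =
      ∑ P : Finpartition (Finset.univ : Finset (Fin l)),
        ∑ σ : Equiv.Perm (Fin P.parts.card),
          (-1 : ℝ) ^ (P.parts.card - 1) / P.parts.card *
            ∫ x in Set.univ.pi fun _ => Set.Ici 0,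
              LaguerreEnsemble.cyclicIntegrand m α f P σ x) ∧
    momentCumulant (LaguerreEnsemble.law m α) (fun r => LaguerreEnsemble.linStat m (f r)) =
      ∑ P : Finpartition (Finset.univ : Finset (Fin l)),
        ∑ σ : Equiv.Perm (Fin P.parts.card),
          (-1 : ℝ) ^ (P.parts.card - 1) / P.parts.card *
            ∫ x in Set.univ.pi fun _ => Set.Ici 0,
              LaguerreEnsemble.cyclicIntegrand m α f P σ x := by
  open LaguerreEnsemble in
  have hφ : ∀ k, Measurable (laguerreSystem m α k) := fun k => measurable_laguerreFun k
  have hprob := isProbabilityMeasure_laguerre m hα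
  have hint := fun j k : Fin m => (integral_laguerreFun_mul_laguerreFun hα j k).1
  have horth : ∀ j k, ∫ x, laguerreSystem m α j x * laguerreSystem m α k x ∂halfLine =
      if j = k then 1 else 0 := fun j k => by
    simpa only [Fin.ext_iff, laguerreSystem] using (integral_laguerreFun_mul_laguerreFun hα j k).2
  rw [law_eq_ensemble m hα] at hmom ⊢
  have hintB := integrable_prod_mul_mul hl hφ hint horth hf hmom
  set c : Finset (Fin l) → ℝ := fun B =>
    (logDet (Fintype.card (Fin l)) (genMatrix halfLine (laguerreSystem m α) f)).coeff (ind B)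
    with hc
  have hS : ∑ P : Finpartition (Finset.univ : Finset (Fin l)),
      ∑ σ : Equiv.Perm (Fin P.parts.card),
        (-1 : ℝ) ^ (P.parts.card - 1) / P.parts.card *
          ∫ x in Set.univ.pi fun _ => Set.Ici 0, cyclicIntegrand m α f P σ x = c Finset.univ := by
    rw [hc]
    dsimp only
    rw [coeff_logDet_genMatrix hintB]
    refine Finset.sum_congr rfl fun P _ => Finset.sum_congr rfl fun σ _ => ?_
    rw [volume_restrict_orthant, integral_congr_ae (cyclicIntegrand_ae_eq hα f P σ)]
  -- This is the recursion to which both the derivatives and the moment formula are compared.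
  have hrec : ∀ (B : Finset (Fin l)) (r : Fin l), (∀ q ∈ B, q < r) →
      ∫ x, ∏ q ∈ insert r B, linStat m (f q) x ∂(ensemble halfLine (laguerreSystem m α)) =
      ∑ C ∈ B.powerset, c (insert r C) *
        ∫ x, ∏ q ∈ B \ C, linStat m (f q) x ∂(ensemble halfLine (laguerreSystem m α)) :=
    fun B r hr => ensemble_recursion hφ hintB horth fun h => (hr r h).false
  rw [hS]
  refine ⟨fun B => (integral_ensemble_prod hφ hintB horth B).1, fun P σ => ?_, ?_, ?_⟩
  · rw [IntegrableOn, volume_restrict_orthant]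
    exact (integral_cyclic_projKernel (h := fun j x => ∏ r ∈ numbering P σ j, f r x)
      fun j => hintB (numbering P σ j)).1.congr (cyclicIntegrand_ae_eq hα f P σ).symm
  · intro a b hab hall hexp
    exact iteratedFDerivWithin_jointCGF hl hab (fun r => allMoments_linStat hm (hf r) (hall r))
      hexp hrec
  · have h0 : ∫ x, ∏ q ∈ (∅ : Finset (Fin l)), linStat m (f q) x
        ∂(ensemble halfLine (laguerreSystem m α)) = 1 := by simp
    exact cumulant_unique (m := fun B => ∫ x, ∏ q ∈ B, linStat m (f q) x
        ∂(ensemble halfLine (laguerreSystem m α)))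
      (c := partitionCumulant fun B => ∫ x, ∏ q ∈ B, linStat m (f q) x
        ∂(ensemble halfLine (laguerreSystem m α))) h0
      (fun B r hr => partitionCumulant_recursion (fun B => ∫ x, ∏ q ∈ B, linStat m (f q) x
        ∂(ensemble halfLine (laguerreSystem m α))) h0 fun h => (hr r h).false) hrec
      ⟨⟨0, hl⟩, Finset.mem_univ _⟩
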